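/- Let $k,l$ be integers with $1\le l<k$, put $p=k/l>1$, and let $0<r\le p$ be real. Let \[A_0(p,r):=1,\qquad A_m(p,r):=\frac{r}{m!}\prod_{i=1}^{m-1}(mp+r-i)\quad(m\ge1),\qquad c(p):=p^p(p-1)^{1-p},\] and for $1\le j\le k$ let \[\alpha_j:=\begin{cases}\dfrac{j}{l}&\text{if }1\le j\le l,\\[2mm]\dfrac{r+j-l}{k-l}&\text{if }l+1\le j\le k,\end{cases}\qquad \beta_j:=\frac{r+j-1}{k}.\] Let $G^{k,0}_{k,k}$ denote the Meijer $G$-function, i.e. for $z\in(0,1)$ \[G^{k,0}_{k,k}\!\left(\begin{array}{c}\alpha_1,\ldots,\alpha_k\\ \beta_1,\ldots,\beta_k\end{array}\middle|\,z\right)=\frac1{2\pi i}\int_{C-i\infty}^{C+i\infty}\frac{\prod_{j=1}^k\Gamma(\beta_j-s)}{\prod_{j=1}^k\Gamma(\alpha_j-s)}\,z^{s}\,ds,\] where $C$ is any real number with $C<\min_j\beta_j$. Theorem. There is a unique probability measure $\mu(p,r)$ on $\mathbb R$ with all moments finite and moment sequence $\{A_m(p,r)\}_{m\ge0}$. It is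 absolutely continuous, with a nonnegative density $W_{p,r}$ that is continuous on $(0,c(p))$ and vanishes outside $(0,c(p))$. For every $x\in(0,c(p))$, the integral defining the $G$-function at $z=x^l/c(p)^l$ converges absolutely for every admissible $C$, its value does not depend on $C$, and \[W_{p,r}(x)=\frac{r\,p^{r}}{x\,(p-1)^{r+1/2}\sqrt{2k\pi}}\;G^{k,0}_{k,k}\!\left(\begin{array}{c}\alpha_1,\ldots,\alpha_k\\ \beta_1,\ldots,\beta_k\end{array}\middle|\,\frac{x^{l}}{c(p)^{l}}\right).\] -/

import Mathlib

open Set MeasureTheory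

noncomputable section

/-- The Raney number `A_m(p,r) = (r / m!) ∏_{i=1}^{m-1} (m p + r - i)`, with `A_0(p,r) = 1`. -/
def raneyNumber (p r : ℝ) (m : ℕ) : ℝ :=
  if m = 0 then 1
  else r / (m.factorial : ℝ) * ∏ i ∈ Finset.Ico 1 m, ((m : ℝ) * p + r - (i : ℝ))

/-- `μ` is a probability measure on `ℝ` all of whose moments are finite, and whose moment
sequence is the sequence of Raney numbers `A_m(p,r)`. -/
structure IsRaneyMeasure (p r : ℝ) (μ : Measure ℝ) : Prop where
  isProbabilityMeasure : IsProbabilityMeasure μ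
  integrable_pow : ∀ m : ℕ, Integrable (fun x : ℝ => x ^ m) μ
  moment_eq : ∀ m : ℕ, ∫ x, x ^ m ∂μ = raneyNumber p r m

/-- `c(p) = p^p (p-1)^(1-p)`. -/
def raneyEndpoint (p : ℝ) : ℝ := p ^ p * (p - 1) ^ (1 - p)

/-- The upper parameters `α_j`; the index `i : Fin k` stands for `j = i + 1`. Thus `α_j = j / l`
for `1 ≤ j ≤ l` and `α_j = (r + j - l) / (k - l)` for `l + 1 ≤ j ≤ k`. -/
def raneyAlpha (k l : ℕ) (r : ℝ) (i : Fin k) : ℝ :=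
  if (i : ℕ) + 1 ≤ l then ((i : ℝ) + 1) / (l : ℝ)
  else (r + ((i : ℝ) + 1) - (l : ℝ)) / ((k : ℝ) - (l : ℝ))

/-- The lower parameters `β_j = (r + j - 1) / k`; the index `i : Fin k` stands for `j = i + 1`. -/
def raneyBeta (k : ℕ) (r : ℝ) (i : Fin k) : ℝ :=
  (r + ((i : ℝ) + 1) - 1) / (k : ℝ)

/-- The quotient of Gamma products in the Mellin-Barnes integral of the Meijer function
`G^{m,n}_{p,q}(a; b | z)`. (At its poles Mathlib's `Complex.Gamma` is `0`, so that the
reciprocal is `0` there too, as it is for the entire function `1 / Γ`.) -/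
def meijerGKernel (m n : ℕ) {p q : ℕ} (a : Fin p → ℂ) (b : Fin q → ℂ) (s : ℂ) : ℂ :=
  ((∏ j ∈ Finset.univ.filter (fun j : Fin q => (j : ℕ) < m), Complex.Gamma (b j - s)) *
      ∏ j ∈ Finset.univ.filter (fun j : Fin p => (j : ℕ) < n), Complex.Gamma (1 - a j + s)) /
    ((∏ j ∈ Finset.univ.filter (fun j : Fin q => m ≤ (j : ℕ)), Complex.Gamma (1 - b j + s)) *
      ∏ j ∈ Finset.univ.filter (fun j : Fin p => n ≤ (j : ℕ)), Complex.Gamma (a j - s))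

/-- The vertical line `Re s = c` separates the poles of the `Γ(b_j - s)`, `j ≤ m` (on its right),
from the poles of the `Γ(1 - a_j + s)`, `j ≤ n` (on its left). -/
def IsMeijerGLine (m n : ℕ) {p q : ℕ} (a : Fin p → ℂ) (b : Fin q → ℂ) (c : ℝ) : Prop :=
  (∀ j : Fin q, (j : ℕ) < m → c < (b j).re) ∧ ∀ j : Fin p, (j : ℕ) < n → (a j).re - 1 < c

/-- The integrand `s ↦ kernel(s) z^s` of the Mellin-Barnes integral. -/
def meijerGIntegrand (m n : ℕ) {p q : ℕ} (a : Fin p → ℂ) (b : Fin q → ℂ) (z s : ℂ) : ℂ :=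
  meijerGKernel m n a b s * z ^ s

/-- The Mellin-Barnes integral `(1 / 2πi) ∫ kernel(s) z^s ds` along the line `Re s = c`,
from `c - i∞` to `c + i∞`, with `s = c + i t` and `ds = i dt`. -/
def meijerGLineIntegral (m n : ℕ) {p q : ℕ} (a : Fin p → ℂ) (b : Fin q → ℂ) (c : ℝ) (z : ℂ) : ℂ :=
  1 / (2 * (Real.pi : ℂ)) * ∫ t : ℝ, meijerGIntegrand m n a b z ((c : ℂ) + (t : ℂ) * Complex.I)

/-- A separating vertical line exists, the Mellin-Barnes integral converges absolutely along every
such line, and its value does not depend on the line. -/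
structure MeijerGConverges (m n : ℕ) {p q : ℕ} (a : Fin p → ℂ) (b : Fin q → ℂ) (z : ℂ) : Prop where
  exists_line : ∃ c : ℝ, IsMeijerGLine m n a b c
  integrable : ∀ c : ℝ, IsMeijerGLine m n a b c →
    Integrable fun t : ℝ => meijerGIntegrand m n a b z ((c : ℂ) + (t : ℂ) * Complex.I)
  integral_eq : ∀ c c' : ℝ, IsMeijerGLine m n a b c → IsMeijerGLine m n a b c' →
    meijerGLineIntegral m n a b c z = meijerGLineIntegral m n a b c' z

open Classical in
/-- The Meijer function `G^{m,n}_{p,q}(a; b | z)`, as the Mellin-Barnes integral along a vertical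
line that separates the two families of poles. It is meaningful when `MeijerGConverges` holds,
and is then the value of the integral along every separating line. -/
def meijerG (m n : ℕ) {p q : ℕ} (a : Fin p → ℂ) (b : Fin q → ℂ) (z : ℂ) : ℂ :=
  if h : ∃ c : ℝ, IsMeijerGLine m n a b c then meijerGLineIntegral m n a b h.choose z else 0

end

/-!
The density is `W(x) = Im (B ^ r) / (π x)`, where `B` is the solution in the upper half-plane of
`B ^ p = x (B - 1)`, an equation satisfied (with `x = 1 / z`) by the generating function
`B = 1 + z B ^ p` of the Raney numbers with `r = 1`. The solutions form a curve parametrized by the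
argument `φ ∈ (0, π / p)` of `B`, with
`|B| = sin (p φ) / sin ((p - 1) φ)` and `|B - 1| = sin φ / sin ((p - 1) φ)`. The abscissa `x`
decreases strictly from `c(p)` to `0` along it (`raneyLogDeriv_neg`, `image_raneyAbscissa`), so
`W` is a continuous function on `(0, c(p))`; it is nonnegative because `0 ≤ r φ ≤ π`, which is
where `r ≤ p` enters.

Everything else follows from the Mellin transform
`∫ x ^ s W(x) dx = r Γ(p s + r) / (Γ(s + 1) Γ((p - 1) s + r + 1))` for `Re s > -r / p`
(`mellin_raneyProfile`). For `0 < s < 1` an integration by parts turns the left side into the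
imaginary part of `r / (π s) ∫ b ^ (p s + r - 1) (b - 1) ^ (-s) db` along the curve. The integrand
is holomorphic in the upper half-plane, and `raneyPrimitive`, the integral along the segment from
`0`, is a primitive that extends continuously to the real axis. Hence only the end point
`p / (p - 1)` of the curve contributes, and of the segment leading there only the part from `0` to
`1` has a non-real integrand; it gives a Beta integral (`im_integral_rpow_mul_upperPow`). The
identity theorem extends the formula to the half-plane.

At the natural numbers the formula gives the moments (`raneyMellin_natCast`), and a measure whose
moments are bounded by `c(p) ^ m` is determined by them, since its characteristic function is the
sum of its moment series (`measure_eq_of_moment_eq`). On the other hand, Gauss's multiplication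
formula (`Complex.prod_Gamma_add_div`) identifies the kernel of the Meijer function at `-s / l`
with the Mellin transform at `s`, up to a constant times `c(p) ^ (-s)` (`meijerGKernel_raney`). A bound for Beta integrals shows that
`Γ(σ₁ + i t) / Γ(σ₂ + i t)` is `O(|t| ^ (σ₁ - σ₂))` (`Gamma_div_Gamma_isBigO`). Since
`∑ (β_j - α_j) = -3 / 2`, the kernel is integrable on vertical lines, and Mellin inversion
evaluates the Mellin–Barnes integral along every admissible line (`meijerGLineIntegral_raney`).
-/

open Filter Topology

noncomputable section

/-! ### Determinacy of measures with geometrically bounded moments -/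

/-- If the moments grow at most geometrically, the exponential series may be integrated term by
term, so that the characteristic function is determined by the moments. -/
theorem hasSum_charFun_of_moment_le {μ : Measure ℝ} [IsProbabilityMeasure μ]
    (hμ : ∀ m : ℕ, Integrable (fun x : ℝ => x ^ m) μ) {K : ℝ}
    (hK : ∀ m : ℕ, ∫ x, x ^ m ∂μ ≤ K ^ m) (t : ℝ) :
    HasSum (fun m : ℕ => ((t : ℂ) * Complex.I) ^ m / (m.factorial : ℂ) *
      ((∫ x, x ^ m ∂μ : ℝ) : ℂ)) (charFun μ t) := by
  set F : ℕ → ℝ → ℂ := fun m x => ((t : ℂ) * Complex.I) ^ m / (m.factorial : ℂ) * ((x ^ m : ℝ) : ℂ)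
  have hF : ∀ m, Integrable (F m) μ := fun m => ((hμ m).ofReal).const_mul _
  have habs : ∀ m : ℕ, ∫ x, |x| ^ m ∂μ ≤ 1 + (K ^ 2) ^ m := by
    intro m
    have h1 : ∀ x : ℝ, |x| ^ m ≤ 1 + x ^ (2 * m) := by
      intro x
      have : x ^ (2 * m) = (|x| ^ m) ^ 2 := by
        rw [← pow_mul, mul_comm m 2, pow_mul, pow_mul, sq_abs]
      rw [this]
      nlinarith [sq_nonneg (|x| ^ m - 1), sq_nonneg (|x| ^ m)]
    have hi : Integrable (fun x : ℝ => |x| ^ m) μ := by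
      have := (hμ m).abs
      simpa [abs_pow] using this
    calc ∫ x, |x| ^ m ∂μ ≤ ∫ x, (1 + x ^ (2 * m)) ∂μ :=
          integral_mono hi ((integrable_const _).add (hμ _)) h1
      _ = 1 + ∫ x, x ^ (2 * m) ∂μ := by
          rw [integral_add (integrable_const _) (hμ _)]; simp
      _ ≤ 1 + (K ^ 2) ^ m := by
          have := hK (2 * m)
          rw [pow_mul] at this
          linarith
  have hnorm : ∀ m, ∫ x, ‖F m x‖ ∂μ ≤
      |t| ^ m / (m.factorial : ℝ) + (|t| * K ^ 2) ^ m / (m.factorial : ℝ) := by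
    intro m
    have : ∀ x, ‖F m x‖ = |t| ^ m / (m.factorial : ℝ) * |x| ^ m := by
      intro x
      simp [F]
    simp_rw [this]
    rw [integral_const_mul]
    calc _ ≤ |t| ^ m / (m.factorial : ℝ) * (1 + (K ^ 2) ^ m) := by
          gcongr
          exact habs m
      _ = _ := by rw [mul_pow]; ring
  have hsum : Summable fun m => ∫ x, ‖F m x‖ ∂μ :=
    Summable.of_nonneg_of_le (fun m => integral_nonneg fun _ => norm_nonneg _) hnorm
      ((Real.summable_pow_div_factorial _).add (Real.summable_pow_div_factorial _))
  have := hasSum_integral_of_summable_integral_norm hF hsum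
  have h2 : charFun μ t = ∫ x, ∑' m, F m x ∂μ := by
    rw [charFun_apply_real]
    congr 1
    ext x
    rw [Complex.exp_eq_exp_ℂ, NormedSpace.exp_eq_tsum_div]
    refine tsum_congr fun m => ?_
    simp only [F]
    push_cast
    ring
  have h3 : ∀ m, ∫ x, F m x ∂μ = ((t : ℂ) * Complex.I) ^ m / (m.factorial : ℂ) *
      ((∫ x, x ^ m ∂μ : ℝ) : ℂ) := fun m => by
    simp only [F]
    rw [integral_const_mul, integral_complex_ofReal]
  rw [h2]
  simpa only [h3] using this

theorem measure_eq_of_moment_eq {μ ν : Measure ℝ} [IsProbabilityMeasure μ] [IsProbabilityMeasure ν]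
    (hμ : ∀ m : ℕ, Integrable (fun x : ℝ => x ^ m) μ)
    (hν : ∀ m : ℕ, Integrable (fun x : ℝ => x ^ m) ν)
    (h : ∀ m : ℕ, ∫ x, x ^ m ∂μ = ∫ x, x ^ m ∂ν) {K : ℝ}
    (hK : ∀ m : ℕ, ∫ x, x ^ m ∂μ ≤ K ^ m) : μ = ν := by
  apply Measure.ext_of_charFun
  ext t
  have h1 := hasSum_charFun_of_moment_le hμ hK t
  have h2 := hasSum_charFun_of_moment_le hν (fun m => h m ▸ hK m) t
  simp_rw [h] at h1
  exact h1.unique h2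

/-! ### Gauss's multiplication formula for the Gamma function -/

/-- The factors `z + i / m + j` of the `m` sequences `GammaSeq (z + i / m) n` are, up to the
factor `1 / m`, the consecutive factors of `GammaSeq (m z)`. -/
theorem prod_prod_add_div_add (m : ℕ) (hm : 0 < m) (z : ℂ) (n : ℕ) :
    ∏ i ∈ Finset.range m, ∏ j ∈ Finset.range n, (z + i / m + j) =
      (∏ q ∈ Finset.range (m * n), (m * z + q)) / (m : ℂ) ^ (m * n) := by
  have hm' : (m : ℂ) ≠ 0 := by exact_mod_cast hm.ne'
  induction n with
  | zero => simp
  | succ n ih =>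
    simp_rw [Finset.prod_range_succ _ n]
    rw [Finset.prod_mul_distrib, ih, mul_add, mul_one, Finset.prod_range_add, pow_add,
      mul_div_mul_comm]
    congr 1
    have hc : (m : ℂ) ^ m = ∏ _i ∈ Finset.range m, (m : ℂ) := by simp
    rw [eq_div_iff (pow_ne_zero _ hm'), hc, ← Finset.prod_mul_distrib]
    refine Finset.prod_congr rfl fun i _ => ?_
    push_cast
    field_simp
    ring

/-- The limit that produces the constant in the multiplication formula, by Stirling's formula. -/
theorem tendsto_gauss_multiplication_const (m : ℕ) (hm : 0 < m) :
    Tendsto (fun n : ℕ => (n : ℝ) ^ (((m : ℝ) - 1) / 2) * (n.factorial : ℝ) ^ m *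
      (m : ℝ) ^ (m * (n + 1)) / ((m * (n + 1) - 1).factorial : ℝ)) atTop
      (𝓝 ((2 * Real.pi) ^ (((m : ℝ) - 1) / 2) * (m : ℝ) ^ (1 / 2 : ℝ))) := by
  have hm' : (0 : ℝ) < m := by exact_mod_cast hm
  have hS := Stirling.tendsto_stirlingSeq_sqrt_pi
  have h1 : Tendsto (fun n : ℕ => Stirling.stirlingSeq (n + 1)) atTop (𝓝 √Real.pi) :=
    hS.comp (tendsto_add_atTop_nat 1)
  have h2 : Tendsto (fun n : ℕ => Stirling.stirlingSeq (m * (n + 1))) atTop (𝓝 √Real.pi) :=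
    hS.comp (tendsto_atTop_mono (fun n => by
      have := Nat.le_mul_of_pos_left (n + 1) hm
      simp only [id]
      omega) tendsto_id)
  have hpi : √Real.pi ≠ 0 := by positivity
  have h3 : Tendsto (fun n : ℕ => ((n : ℝ) / ((n : ℝ) + 1)) ^ (((m : ℝ) - 1) / 2)) atTop
      (𝓝 1) := by
    have := (tendsto_natCast_div_add_atTop (1 : ℝ)).rpow_const (p := ((m : ℝ) - 1) / 2)
      (Or.inl one_ne_zero)
    simpa using this
  have h4 := ((h3.mul ((h1.pow m).div h2 hpi)).mul_const
    ((2 : ℝ) ^ (((m : ℝ) - 1) / 2) * (m : ℝ) ^ (1 / 2 : ℝ)))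
  have hlim : 1 * (√Real.pi ^ m / √Real.pi) * (2 ^ (((m : ℝ) - 1) / 2) * (m : ℝ) ^ (1 / 2 : ℝ)) =
      (2 * Real.pi) ^ (((m : ℝ) - 1) / 2) * (m : ℝ) ^ (1 / 2 : ℝ) := by
    have h5 : √Real.pi ^ m / √Real.pi = Real.pi ^ (((m : ℝ) - 1) / 2) := by
      rw [Real.sqrt_eq_rpow, ← Real.rpow_mul_natCast Real.pi_pos.le, ← Real.rpow_sub Real.pi_pos]
      congr 1
      ring
    rw [h5, Real.mul_rpow (by norm_num) Real.pi_pos.le]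
    ring
  rw [hlim] at h4
  refine h4.congr' ?_
  filter_upwards [eventually_gt_atTop 0] with n hn
  have hn' : (0 : ℝ) < n := by exact_mod_cast hn
  have hM : (0 : ℝ) < (n : ℝ) + 1 := by positivity
  have hfac : ((m * (n + 1)).factorial : ℝ) =
      m * ((n : ℝ) + 1) * ((m * (n + 1) - 1).factorial : ℝ) := by
    rw [← Nat.mul_factorial_pred (Nat.mul_pos hm n.succ_pos).ne']
    push_cast
    ring
  have hs1 : √(2 * ((n : ℝ) + 1)) ^ m =
      (2 : ℝ) ^ (((m : ℝ) - 1) / 2) * ((n : ℝ) + 1) ^ (((m : ℝ) - 1) / 2) *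
        √(2 * ((n : ℝ) + 1)) := by
    rw [Real.sqrt_eq_rpow, ← Real.rpow_mul_natCast (by positivity),
      ← Real.mul_rpow (by norm_num) hM.le, ← Real.rpow_add (by positivity)]
    congr 1
    ring
  have hs2 : √(2 * ((m : ℝ) * ((n : ℝ) + 1))) = √(2 * ((n : ℝ) + 1)) * (m : ℝ) ^ (1 / 2 : ℝ) := by
    rw [← Real.sqrt_eq_rpow, ← Real.sqrt_mul (by positivity)]
    congr 1
    ring
  have hm2 : (m : ℝ) ^ (1 / 2 : ℝ) * (m : ℝ) ^ (1 / 2 : ℝ) = m := by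
    rw [← Real.rpow_add hm']
    norm_num
  have hM2 : ((n : ℝ) + 1) ^ (((m : ℝ) - 1) / 2) * ((n : ℝ) + 1) ^ (((m : ℝ) - 1) / 2) *
      ((n : ℝ) + 1) = ((n : ℝ) + 1) ^ m := by
    rw [← Real.rpow_add hM, ← Real.rpow_add_one hM.ne', ← Real.rpow_natCast]
    congr 1
    ring
  simp only [Stirling.stirlingSeq, Pi.div_apply]
  rw [hfac, Nat.factorial_succ,
    Real.div_rpow hn'.le hM.le]
  push_cast
  rw [div_pow, mul_pow, mul_pow, hs1, hs2, mul_div_assoc (m : ℝ), mul_pow (m : ℝ),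
    ← pow_mul (((n : ℝ) + 1) / Real.exp 1), mul_comm (n + 1) m, ← hM2]
  have e1 : 0 < √(2 * ((n : ℝ) + 1)) := by positivity
  have e2 : 0 < (((n : ℝ) + 1) / Real.exp 1) ^ (m * (n + 1)) := by positivity
  have e3 : 0 < ((n : ℝ) + 1) ^ (((m : ℝ) - 1) / 2) := by positivity
  have e4 : 0 < (2 : ℝ) ^ (((m : ℝ) - 1) / 2) := by positivity
  have e5 : (0 : ℝ) < ((m * (n + 1) - 1).factorial : ℝ) := by positivity
  have e6 : (0 : ℝ) < (m : ℝ) ^ (1 / 2 : ℝ) := by positivity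
  generalize √(2 * ((n : ℝ) + 1)) = A at *
  generalize (((n : ℝ) + 1) / Real.exp 1) ^ (m * (n + 1)) = B at *
  generalize ((n : ℝ) + 1) ^ (((m : ℝ) - 1) / 2) = C at *
  generalize (2 : ℝ) ^ (((m : ℝ) - 1) / 2) = D at *
  generalize ((m * (n + 1) - 1).factorial : ℝ) = E at *
  generalize (m : ℝ) ^ (1 / 2 : ℝ) = F at *
  field_simp
  rw [← hm2]
  ring

/-- Gauss's multiplication formula. -/
theorem Complex.prod_Gamma_add_div (m : ℕ) (hm : 0 < m) (z : ℂ) :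
    ∏ i ∈ Finset.range m, Complex.Gamma (z + i / m) =
      (((2 * Real.pi) ^ (((m : ℝ) - 1) / 2) : ℝ) : ℂ) * (m : ℂ) ^ (1 / 2 - m * z) *
        Complex.Gamma (m * z) := by
  have hm' : (0 : ℝ) < m := by exact_mod_cast hm
  have hmC : (m : ℂ) ≠ 0 := by exact_mod_cast hm.ne'
  set N : ℕ → ℕ := fun n => m * (n + 1) - 1
  have hN1 : ∀ n, N n + 1 = m * (n + 1) := fun n =>
    Nat.sub_add_cancel (Nat.mul_pos hm n.succ_pos)
  have hNn : ∀ n, n ≤ N n := fun n => by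
    have := Nat.le_mul_of_pos_left (n + 1) hm
    have := hN1 n
    omega
  have hNt : Tendsto N atTop atTop := tendsto_atTop_mono hNn tendsto_id
  have hL : Tendsto (fun n => ∏ i ∈ Finset.range m, Complex.GammaSeq (z + i / m) n) atTop
      (𝓝 (∏ i ∈ Finset.range m, Complex.Gamma (z + i / m))) :=
    tendsto_finsetProd _ fun i _ => Complex.GammaSeq_tendsto_Gamma _
  have hR : Tendsto (fun n => Complex.GammaSeq (m * z) (N n)) atTop (𝓝 (Complex.Gamma (m * z))) :=
    (Complex.GammaSeq_tendsto_Gamma _).comp hNt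
  have hD := (Complex.continuous_ofReal.tendsto _).comp (tendsto_gauss_multiplication_const m hm)
  have hq : Tendsto (fun n : ℕ => (((n : ℝ) / (N n : ℝ) : ℝ) : ℂ) ^ ((m : ℂ) * z)) atTop
      (𝓝 ((((1 / m : ℝ)) : ℂ) ^ ((m : ℂ) * z))) := by
    have h1 : Tendsto (fun n : ℕ => (n : ℝ) / (N n : ℝ)) atTop (𝓝 (1 / m : ℝ)) := by
      have h2 := (tendsto_inv_atTop_nhds_zero_nat (𝕜 := ℝ)).const_mul ((m : ℝ) - 1)
      have h3 := ((tendsto_const_nhds (x := (m : ℝ))).add h2).inv₀ (by simpa using hm'.ne')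
      rw [mul_zero, add_zero] at h3
      rw [one_div]
      refine h3.congr' ?_
      filter_upwards [eventually_gt_atTop 0] with n hn
      have hn' : (0 : ℝ) < n := by exact_mod_cast hn
      have h4 : (N n : ℝ) = m * n + (m - 1) := by
        have h5 : ((N n + 1 : ℕ) : ℝ) = ((m * (n + 1) : ℕ) : ℝ) := by rw [hN1]
        push_cast at h5
        linarith
      rw [h4, ← inv_div]
      congr 1
      field_simp
    have hcont : ContinuousAt (fun x : ℝ => (x : ℂ) ^ ((m : ℂ) * z)) (1 / m : ℝ) :=
      Complex.continuousAt_ofReal_cpow_const _ _ (Or.inr (by positivity))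
    exact hcont.tendsto.comp h1
  have hall := (hD.mul hq).mul hR
  have hlim : (((2 * Real.pi) ^ (((m : ℝ) - 1) / 2) * (m : ℝ) ^ (1 / 2 : ℝ) : ℝ) : ℂ) *
      (((1 / m : ℝ)) : ℂ) ^ ((m : ℂ) * z) = (((2 * Real.pi) ^ (((m : ℝ) - 1) / 2) : ℝ) : ℂ) *
        (m : ℂ) ^ (1 / 2 - m * z) := by
    have h1 : (((1 / m : ℝ)) : ℂ) ^ ((m : ℂ) * z) = ((m : ℂ) ^ ((m : ℂ) * z))⁻¹ := by
      rw [← Complex.inv_cpow _ _ (by rw [Complex.natCast_arg]; exact Real.pi_pos.ne)]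
      push_cast
      rw [one_div]
    rw [Complex.cpow_sub _ _ hmC, h1, Complex.ofReal_mul, Complex.ofReal_cpow hm'.le]
    push_cast
    ring
  rw [hlim] at hall
  refine tendsto_nhds_unique (hL.congr' ?_) hall
  filter_upwards [eventually_gt_atTop 0] with n hn
  have hn' : (0 : ℝ) < n := by exact_mod_cast hn
  have hnC : (n : ℂ) ≠ 0 := by exact_mod_cast hn.ne'
  have hNpos : 0 < N n := lt_of_lt_of_le hn (hNn n)
  have hNC : (N n : ℂ) ≠ 0 := by exact_mod_cast hNpos.ne'
  simp only [Complex.GammaSeq, Function.comp]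
  rw [Finset.prod_div_distrib, prod_prod_add_div_add m hm, Finset.prod_mul_distrib,
    Finset.prod_const, Finset.card_range, hN1]
  have hpow : ∏ i ∈ Finset.range m, (n : ℂ) ^ (z + i / m) =
      (n : ℂ) ^ ((m : ℂ) * z) * (((n : ℝ) ^ (((m : ℝ) - 1) / 2) : ℝ) : ℂ) := by
    have hsum : ∑ i ∈ Finset.range m, (z + (i : ℂ) / m) =
        (m : ℂ) * z + (((m : ℝ) - 1) / 2 : ℝ) := by
      have h1 : (∑ i ∈ Finset.range m, (i : ℂ)) * 2 = m * (m - 1) := by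
        have := congrArg (Nat.cast : ℕ → ℂ) (Finset.sum_range_id_mul_two m)
        push_cast [Nat.cast_sub hm] at this
        exact this
      rw [Finset.sum_add_distrib, ← Finset.sum_div, Finset.sum_const, Finset.card_range,
        nsmul_eq_mul, ← mul_div_cancel_right₀ (∑ i ∈ Finset.range m, (i : ℂ)) two_ne_zero, h1]
      push_cast
      field_simp
    simp_rw [Complex.cpow_def_of_ne_zero hnC]
    rw [← Complex.exp_sum, ← Finset.mul_sum, hsum, mul_add, Complex.exp_add,
      ← Complex.cpow_def_of_ne_zero hnC (((((m : ℝ) - 1) / 2 : ℝ)) : ℂ),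
      Complex.ofReal_cpow hn'.le, Complex.ofReal_natCast]
  have hsplit : (n : ℂ) ^ ((m : ℂ) * z) =
      (((n : ℝ) / (N n : ℝ) : ℝ) : ℂ) ^ ((m : ℂ) * z) * (N n : ℂ) ^ ((m : ℂ) * z) := by
    rw [← Complex.ofReal_natCast (N n), ← Complex.mul_cpow_ofReal_nonneg (by positivity)
      (by positivity), ← Complex.ofReal_mul, div_mul_cancel₀ _ (by exact_mod_cast hNpos.ne'),
      Complex.ofReal_natCast]
  have hfacN : ((N n).factorial : ℂ) ≠ 0 := by exact_mod_cast (N n).factorial_ne_zero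
  rw [hpow, hsplit, show m * (n + 1) - 1 = N n from rfl]
  push_cast
  field_simp

/-! ### Growth of quotients of Gamma functions along vertical lines -/

/-- Integration by parts away from the endpoint `1`, and a trivial bound on an interval of
length `1 / |t|` next to it, give the decay of the Beta integral in the imaginary direction. -/
theorem exists_norm_betaIntegral_le {σ a : ℝ} (hσ : 0 < σ) (ha : 0 < a) (ha1 : a < 1) :
    ∃ C : ℝ, ∀ t : ℝ, 2 ≤ |t| →
      ‖Complex.betaIntegral (σ + t * Complex.I) a‖ ≤ C * |t| ^ (-a) := by
  refine ⟨((1 / 2 : ℝ) ^ (σ - 1) + 1) / a + 2, fun t ht => ?_⟩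
  have htpos : 0 < |t| := by linarith
  set z : ℂ := σ + t * Complex.I with hz
  have hzre : z.re = σ := by simp [hz]
  have hzim : z.im = t := by simp [hz]
  have hz0 : z ≠ 0 := fun h => by rw [h] at hzre; simp at hzre; linarith
  set δ : ℝ := |t|⁻¹ with hδ
  have hδ0 : 0 < δ := inv_pos.mpr htpos
  have hδ2 : δ ≤ 1 / 2 := by rw [hδ, one_div]; exact inv_anti₀ (by norm_num) ht
  have hδa : |t| ^ (-a) = δ ^ a := by
    rw [Real.rpow_neg htpos.le, hδ, Real.inv_rpow htpos.le]
  have hint := Complex.betaIntegral_convergent (u := z) (v := (a : ℂ)) (by rw [hzre]; exact hσ)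
    (by simpa using ha)
  have hi1 : IntervalIntegrable (fun x : ℝ => (x : ℂ) ^ (z - 1) * (1 - (x : ℂ)) ^ ((a : ℂ) - 1))
      volume 0 (1 - δ) := hint.mono_set (by
        rw [uIcc_of_le (by linarith), uIcc_of_le (by linarith)]
        exact Icc_subset_Icc le_rfl (by linarith))
  have hi2 : IntervalIntegrable (fun x : ℝ => (x : ℂ) ^ (z - 1) * (1 - (x : ℂ)) ^ ((a : ℂ) - 1))
      volume (1 - δ) 1 := hint.mono_set (by
        rw [uIcc_of_le (by linarith), uIcc_of_le (by linarith)]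
        exact Icc_subset_Icc (by linarith) le_rfl)
  have hcast : ∀ x : ℝ, x ≤ 1 → (1 - (x : ℂ)) ^ ((a : ℂ) - 1) = (((1 - x) ^ (a - 1) : ℝ) : ℂ) := by
    intro x hx
    rw [Complex.ofReal_cpow (by linarith)]
    push_cast
    rfl
  -- the part next to the endpoint `1`
  have hnear : ‖∫ x in (1 - δ)..1, (x : ℂ) ^ (z - 1) * (1 - (x : ℂ)) ^ ((a : ℂ) - 1)‖ ≤
      ((1 / 2 : ℝ) ^ (σ - 1) + 1) / a * δ ^ a := by
    have hval : ∫ x in (1 - δ)..1, ((1 / 2 : ℝ) ^ (σ - 1) + 1) * (1 - x) ^ (a - 1) =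
        ((1 / 2 : ℝ) ^ (σ - 1) + 1) / a * δ ^ a := by
      rw [intervalIntegral.integral_const_mul,
        intervalIntegral.integral_comp_sub_left (fun x : ℝ => x ^ (a - 1)) 1,
        integral_rpow (Or.inl (by linarith))]
      simp only [sub_self, sub_sub_cancel, sub_add_cancel]
      rw [Real.zero_rpow ha.ne']
      ring
    rw [← hval]
    refine intervalIntegral.norm_integral_le_of_norm_le (by linarith) ?_ ?_
    · refine Eventually.of_forall fun x hx => ?_
      rw [norm_mul, hcast x hx.2, Complex.norm_real, Real.norm_of_nonneg
        (Real.rpow_nonneg (by linarith [hx.2]) _)]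
      have hx0 : 0 < x := by linarith [hx.1]
      rw [Complex.norm_cpow_eq_rpow_re_of_pos hx0]
      refine mul_le_mul_of_nonneg_right ?_ (Real.rpow_nonneg (by linarith [hx.2]) _)
      have hre : (z - 1).re = σ - 1 := by simp [hzre]
      rw [hre]
      rcases le_total 0 (σ - 1) with h | h
      · have := Real.rpow_le_one hx0.le hx.2 h
        have := Real.rpow_pos_of_pos (show (0 : ℝ) < 1 / 2 by norm_num) (σ - 1)
        linarith
      · have := Real.rpow_le_rpow_of_nonpos (show (0 : ℝ) < 1 / 2 by norm_num)
          (show 1 / 2 ≤ x by linarith [hx.1]) h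
        linarith
    · apply IntervalIntegrable.const_mul
      have := (intervalIntegral.intervalIntegrable_rpow' (a := δ) (b := 0) (r := a - 1)
        (by linarith)).comp_sub_left 1
      simpa using this
  -- the remaining part, by parts
  have hfar : ‖∫ x in 0..(1 - δ), (x : ℂ) ^ (z - 1) * (1 - (x : ℂ)) ^ ((a : ℂ) - 1)‖ ≤
      2 * δ ^ a := by
    set u : ℝ → ℝ := fun x => (1 - x) ^ (a - 1) with hu
    set u' : ℝ → ℝ := fun x => (1 - a) * (1 - x) ^ (a - 2) with hu'
    have hderu : ∀ x : ℝ, x < 1 → HasDerivAt u (u' x) x := by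
      intro x hx
      have h1 := ((hasDerivAt_id x).const_sub 1).rpow_const (p := a - 1)
        (Or.inl (by simp only [id]; linarith))
      refine h1.congr_deriv ?_
      simp only [id, hu']
      rw [show a - 1 - 1 = a - 2 by ring]
      ring
    set v : ℝ → ℂ := fun x => (x : ℂ) ^ z / z with hv
    have hvc : Continuous v := by
      refine Continuous.div_const ?_ _
      exact Complex.continuous_ofReal_cpow_const (by rw [hzre]; exact hσ)
    have hderv : ∀ x : ℝ, 0 < x → HasDerivAt v ((x : ℂ) ^ (z - 1)) x := by
      intro x hx
      have := (hasDerivAt_ofReal_cpow_const hx.ne' hz0).div_const z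
      rwa [mul_div_cancel_left₀ _ hz0] at this
    have hu'c : ContinuousOn u' (Icc 0 (1 - δ)) := by
      refine ContinuousOn.mul continuousOn_const ?_
      refine ContinuousOn.rpow_const (by fun_prop) fun x hx => Or.inl ?_
      linarith [hx.2]
    have huc : ContinuousOn u (Icc 0 (1 - δ)) := fun x hx =>
      (hderu x (by linarith [hx.2])).continuousAt.continuousWithinAt
    have hu'int : IntervalIntegrable u' volume 0 (1 - δ) := by
      refine ContinuousOn.intervalIntegrable ?_
      rwa [uIcc_of_le (by linarith)]
    have hv'int : IntervalIntegrable (fun x : ℝ => (x : ℂ) ^ (z - 1)) volume 0 (1 - δ) :=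
      intervalIntegral.intervalIntegrable_cpow' (by simp [hzre, hσ])
    have hparts := intervalIntegral.integral_mul_deriv_eq_deriv_mul_of_hasDeriv_right
      (a := 0) (b := 1 - δ) (u := fun x => ((u x : ℝ) : ℂ)) (v := v)
      (u' := fun x => ((u' x : ℝ) : ℂ)) (v' := fun x : ℝ => (x : ℂ) ^ (z - 1))
      (by rw [uIcc_of_le (by linarith)]; exact Complex.continuous_ofReal.comp_continuousOn huc)
      hvc.continuousOn
      (by
        rw [min_eq_left (by linarith), max_eq_right (by linarith)]
        intro x hx
        exact ((hderu x (by linarith [hx.2])).ofReal_comp).hasDerivWithinAt)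
      (by
        rw [min_eq_left (by linarith), max_eq_right (by linarith)]
        intro x hx
        exact (hderv x hx.1).hasDerivWithinAt)
      (ContinuousOn.intervalIntegrable (by
        rw [uIcc_of_le (by linarith)]; exact Complex.continuous_ofReal.comp_continuousOn hu'c))
      hv'int
    have heq : ∫ x in 0..(1 - δ), (x : ℂ) ^ (z - 1) * (1 - (x : ℂ)) ^ ((a : ℂ) - 1) =
        ∫ x in 0..(1 - δ), ((u x : ℝ) : ℂ) * (x : ℂ) ^ (z - 1) := by
      refine intervalIntegral.integral_congr fun x hx => ?_
      rw [uIcc_of_le (by linarith)] at hx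
      rw [hcast x (by linarith [hx.2]), mul_comm]
    have hvle : ∀ x ∈ Icc (0 : ℝ) 1, ‖v x‖ ≤ δ := by
      intro x hx
      simp only [hv]
      rw [norm_div]
      have h1 : ‖(x : ℂ) ^ z‖ ≤ 1 := by
        rw [Complex.norm_cpow_eq_rpow_re_of_nonneg hx.1 (by rw [hzre]; exact hσ.ne'), hzre]
        exact Real.rpow_le_one hx.1 hx.2 hσ.le
      have h2 : |t| ≤ ‖z‖ := by rw [← hzim]; exact Complex.abs_im_le_norm z
      rw [hδ, ← one_div]
      exact div_le_div₀ zero_le_one h1 htpos h2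
    have hv0 : v 0 = 0 := by simp [hv, Complex.zero_cpow hz0]
    have hu'nn : ∀ x ∈ Icc (0 : ℝ) (1 - δ), 0 ≤ u' x := fun x hx =>
      mul_nonneg (by linarith) (Real.rpow_nonneg (by linarith [hx.2]) _)
    have hFTC : ∫ x in 0..(1 - δ), u' x = u (1 - δ) - u 0 :=
      intervalIntegral.integral_eq_sub_of_hasDerivAt (fun x hx => by
        rw [uIcc_of_le (by linarith)] at hx
        exact hderu x (by linarith [hx.2])) hu'int
    have hrem : ‖∫ x in 0..(1 - δ), ((u' x : ℝ) : ℂ) * v x‖ ≤ δ * (u (1 - δ) - u 0) := by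
      rw [← hFTC, ← intervalIntegral.integral_const_mul]
      refine intervalIntegral.norm_integral_le_of_norm_le (by linarith) ?_ (hu'int.const_mul _)
      refine Eventually.of_forall fun x hx => ?_
      have hx' : x ∈ Icc (0 : ℝ) (1 - δ) := ⟨hx.1.le, hx.2⟩
      rw [norm_mul, Complex.norm_real, Real.norm_of_nonneg (hu'nn x hx'), mul_comm]
      exact mul_le_mul_of_nonneg_right (hvle x ⟨hx.1.le, by linarith [hx.2]⟩) (hu'nn x hx')
    have hud : δ * u (1 - δ) = δ ^ a := by
      simp only [hu, sub_sub_cancel]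
      rw [mul_comm, ← Real.rpow_add_one hδ0.ne', sub_add_cancel]
    have hu0 : u 0 = 1 := by simp [hu]
    have hmain : ‖((u (1 - δ) : ℝ) : ℂ) * v (1 - δ)‖ ≤ u (1 - δ) * δ := by
      have h0 : 0 ≤ u (1 - δ) := by simp only [hu]; exact Real.rpow_nonneg (by linarith) _
      rw [norm_mul, Complex.norm_real, Real.norm_of_nonneg h0]
      exact mul_le_mul_of_nonneg_left (hvle _ ⟨by linarith, by linarith⟩) h0
    rw [heq, hparts, hv0, mul_zero, sub_zero]
    refine (norm_sub_le _ _).trans ?_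
    rw [hu0] at hrem
    nlinarith
  rw [Complex.betaIntegral, ← intervalIntegral.integral_add_adjacent_intervals hi1 hi2, hδa]
  refine (norm_add_le _ _).trans ?_
  linarith

/-- The case of a shift by at most `1` of the comparison of Gamma values on vertical lines. -/
theorem exists_norm_Gamma_le_of_le_one {σ a : ℝ} (hσ : 0 < σ) (ha : 0 ≤ a) (ha1 : a ≤ 1) :
    ∃ C : ℝ, 0 < C ∧ ∀ t : ℝ, 2 ≤ |t| → ‖Complex.Gamma (σ + t * Complex.I)‖ ≤
      C * |t| ^ (-a) * ‖Complex.Gamma ((σ + a : ℝ) + t * Complex.I)‖ := by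
  rcases ha.eq_or_lt with rfl | ha
  · exact ⟨1, one_pos, fun t _ => by simp⟩
  rcases ha1.eq_or_lt with rfl | ha1
  · refine ⟨1, one_pos, fun t ht => ?_⟩
    have htpos : 0 < |t| := by linarith
    have hz0 : (σ + t * Complex.I : ℂ) ≠ 0 := fun h => by
      have := congrArg Complex.re h
      simp at this
      linarith
    have h1 : ((σ + 1 : ℝ) + t * Complex.I : ℂ) = (σ + t * Complex.I) + 1 := by push_cast; ring
    rw [h1, Complex.Gamma_add_one _ hz0, norm_mul, Real.rpow_neg_one, one_mul, ← mul_assoc]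
    have h2 : |t| ≤ ‖(σ + t * Complex.I : ℂ)‖ := by
      have := Complex.abs_im_le_norm (σ + t * Complex.I : ℂ)
      simpa using this
    have h3 : 1 ≤ |t|⁻¹ * ‖(σ + t * Complex.I : ℂ)‖ := by
      rw [inv_mul_eq_div, le_div_iff₀ htpos]
      linarith
    exact le_mul_of_one_le_left (norm_nonneg _) h3
  · obtain ⟨C, hC⟩ := exists_norm_betaIntegral_le hσ ha ha1
    have hΓa : 0 < Real.Gamma a := Real.Gamma_pos_of_pos ha
    refine ⟨max C 1 / Real.Gamma a, by positivity, fun t ht => ?_⟩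
    have h1 := hC t ht
    have hre : 0 < (σ + t * Complex.I : ℂ).re := by simpa using hσ
    have h2 := Complex.Gamma_mul_Gamma_eq_betaIntegral hre (t := (a : ℂ)) (by simpa using ha)
    have h3 : (σ + t * Complex.I + a : ℂ) = ((σ + a : ℝ) + t * Complex.I) := by push_cast; ring
    rw [h3] at h2
    have h4 := congrArg norm h2
    rw [norm_mul, norm_mul, Complex.Gamma_ofReal, Complex.norm_real,
      Real.norm_of_nonneg hΓa.le] at h4
    have h5 : ‖Complex.betaIntegral (σ + t * Complex.I) a‖ ≤ max C 1 * |t| ^ (-a) :=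
      h1.trans (mul_le_mul_of_nonneg_right (le_max_left _ _) (Real.rpow_nonneg (abs_nonneg _) _))
    rw [div_mul_eq_mul_div, div_mul_eq_mul_div, le_div_iff₀ hΓa, h4, mul_comm]
    exact mul_le_mul_of_nonneg_right h5 (norm_nonneg _)

theorem exists_norm_Gamma_le_add {σ d : ℝ} (hσ : 0 < σ) (hd : 0 ≤ d) :
    ∃ C : ℝ, 0 < C ∧ ∀ t : ℝ, 2 ≤ |t| → ‖Complex.Gamma (σ + t * Complex.I)‖ ≤
      C * |t| ^ (-d) * ‖Complex.Gamma ((σ + d : ℝ) + t * Complex.I)‖ := by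
  obtain ⟨n, hn⟩ := exists_nat_ge d
  induction n generalizing σ d with
  | zero =>
    have : d = 0 := le_antisymm (by simpa using hn) hd
    subst this
    exact exists_norm_Gamma_le_of_le_one hσ le_rfl zero_le_one
  | succ n ih =>
    rcases le_total d 1 with h1 | h1
    · exact exists_norm_Gamma_le_of_le_one hσ hd h1
    obtain ⟨C, hC0, hC⟩ := exists_norm_Gamma_le_of_le_one hσ zero_le_one le_rfl
    push_cast at hn
    obtain ⟨D, hD0, hD⟩ := ih (σ := σ + 1) (d := d - 1) (by linarith) (by linarith) (by linarith)
    refine ⟨C * D, by positivity, fun t ht => ?_⟩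
    have htpos : 0 < |t| := by linarith
    have h2 := hD t ht
    rw [show σ + 1 + (d - 1) = σ + d by ring] at h2
    calc _ ≤ _ := hC t ht
      _ ≤ C * |t| ^ (-1 : ℝ) * (D * |t| ^ (-(d - 1)) *
            ‖Complex.Gamma ((σ + d : ℝ) + t * Complex.I)‖) := by gcongr
      _ = C * D * (|t| ^ (-1 : ℝ) * |t| ^ (-(d - 1))) *
            ‖Complex.Gamma ((σ + d : ℝ) + t * Complex.I)‖ := by ring
      _ = _ := by
        rw [← Real.rpow_add htpos]
        congr 3
        ring

theorem exists_norm_Gamma_add_nat_le {σ : ℝ} (hσ : 0 < σ) (n : ℕ) :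
    ∃ C : ℝ, 0 < C ∧ ∀ t : ℝ, 2 ≤ |t| → ‖Complex.Gamma ((σ + n : ℝ) + t * Complex.I)‖ ≤
      C * |t| ^ (n : ℝ) * ‖Complex.Gamma (σ + t * Complex.I)‖ := by
  induction n with
  | zero => exact ⟨1, one_pos, fun t _ => by simp⟩
  | succ n ih =>
    obtain ⟨C, hC0, hC⟩ := ih
    refine ⟨C * (σ + n + 1), by positivity, fun t ht => ?_⟩
    have htpos : 0 < |t| := by linarith
    have hσn : 0 < σ + n := by positivity
    have hz0 : ((σ + n : ℝ) + t * Complex.I : ℂ) ≠ 0 := fun h => by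
      have := congrArg Complex.re h
      simp at this
      linarith
    have h1 : ((σ + (n + 1 : ℕ) : ℝ) + t * Complex.I : ℂ) =
      ((σ + n : ℝ) + t * Complex.I) + 1 := by push_cast; ring
    have h2 : ‖((σ + n : ℝ) + t * Complex.I : ℂ)‖ ≤ (σ + n + 1) * |t| := by
      refine (norm_add_le _ _).trans ?_
      rw [norm_mul, Complex.norm_I, mul_one, Complex.norm_real, Complex.norm_real,
        Real.norm_of_nonneg hσn.le, Real.norm_eq_abs]
      nlinarith
    rw [h1, Complex.Gamma_add_one _ hz0, norm_mul]
    calc _ ≤ ((σ + n + 1) * |t|) * (C * |t| ^ (n : ℝ) * ‖Complex.Gamma (σ + t * Complex.I)‖) :=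
          mul_le_mul h2 (hC t ht) (norm_nonneg _) (by positivity)
      _ = _ := by
        push_cast
        rw [Real.rpow_add_one htpos.ne']
        ring

/-- On vertical lines in the right half-plane, `Γ(σ₁ + it) / Γ(σ₂ + it)` grows at most like
`|t| ^ (σ₁ - σ₂)`. -/
theorem Gamma_div_Gamma_isBigO {σ₁ σ₂ : ℝ} (h₁ : 0 < σ₁) (h₂ : 0 < σ₂) :
    (fun t : ℝ => Complex.Gamma (σ₁ + t * Complex.I) / Complex.Gamma (σ₂ + t * Complex.I))
      =O[cocompact ℝ] fun t : ℝ => |t| ^ (σ₁ - σ₂) := by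
  suffices h : ∃ C : ℝ, 0 < C ∧ ∀ t : ℝ, 2 ≤ |t| → ‖Complex.Gamma (σ₁ + t * Complex.I)‖ ≤
      C * |t| ^ (σ₁ - σ₂) * ‖Complex.Gamma (σ₂ + t * Complex.I)‖ by
    obtain ⟨C, hC0, hC⟩ := h
    refine Asymptotics.IsBigO.of_bound C ?_
    have : ∀ᶠ t : ℝ in cocompact ℝ, 2 ≤ ‖t‖ := tendsto_norm_cocompact_atTop.eventually_ge_atTop 2
    filter_upwards [this] with t ht
    have hΓ : Complex.Gamma (σ₂ + t * Complex.I) ≠ 0 :=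
      Complex.Gamma_ne_zero_of_re_pos (by simpa using h₂)
    rw [norm_div, div_le_iff₀ (norm_pos_iff.mpr hΓ),
      Real.norm_of_nonneg (Real.rpow_nonneg (abs_nonneg _) _)]
    exact hC t ht
  rcases le_total σ₁ σ₂ with h | h
  · obtain ⟨C, hC0, hC⟩ := exists_norm_Gamma_le_add (d := σ₂ - σ₁) h₁ (by linarith)
    refine ⟨C, hC0, fun t ht => ?_⟩
    have := hC t ht
    rwa [neg_sub, add_sub_cancel] at this
  · obtain ⟨n, hn⟩ := exists_nat_ge (σ₁ - σ₂)
    obtain ⟨C, hC0, hC⟩ := exists_norm_Gamma_le_add (d := n - (σ₁ - σ₂)) h₁ (by linarith)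
    obtain ⟨D, hD0, hD⟩ := exists_norm_Gamma_add_nat_le h₂ n
    refine ⟨C * D, by positivity, fun t ht => ?_⟩
    have htpos : 0 < |t| := by linarith
    have h3 := hC t ht
    rw [show σ₁ + (n - (σ₁ - σ₂)) = σ₂ + n by ring] at h3
    calc _ ≤ _ := h3
      _ ≤ C * |t| ^ (-(n - (σ₁ - σ₂))) *
          (D * |t| ^ (n : ℝ) * ‖Complex.Gamma (σ₂ + t * Complex.I)‖) := by
        gcongr
        exact hD t ht
      _ = C * D * (|t| ^ (-(n - (σ₁ - σ₂))) * |t| ^ (n : ℝ)) *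
          ‖Complex.Gamma (σ₂ + t * Complex.I)‖ := by ring
      _ = _ := by
        rw [← Real.rpow_add htpos]
        congr 3
        ring

/-! ### The curve on which `B ^ p / (B - 1)` is real -/

/-- The modulus `sin (p φ) / sin ((p - 1) φ)` of the point with argument `φ` on the curve in the
upper half-plane where `B ^ p / (B - 1)` is real. -/
def raneyRadius (p φ : ℝ) : ℝ := Real.sin (p * φ) / Real.sin ((p - 1) * φ)

/-- The modulus `sin φ / sin ((p - 1) φ)` of `B - 1`, for `B` the point with argument `φ` on the
curve. -/
def raneyShift (p φ : ℝ) : ℝ := Real.sin φ / Real.sin ((p - 1) * φ)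

/-- The point with argument `φ` on the curve. -/
def raneyPoint (p φ : ℝ) : ℂ := raneyRadius p φ * Complex.exp (φ * Complex.I)

/-- The value of `B ^ p / (B - 1)` at the point `B` with argument `φ` on the curve. -/
def raneyAbscissa (p φ : ℝ) : ℝ := raneyRadius p φ ^ p / raneyShift p φ

theorem raney_angle_bounds {p φ : ℝ} (hp : 1 < p) (hφ : φ ∈ Ioo 0 (Real.pi / p)) :
    0 < φ ∧ p * φ < Real.pi ∧ φ < Real.pi ∧ 0 < (p - 1) * φ ∧ (p - 1) * φ < Real.pi := by
  have h0 : 0 < φ := hφ.1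
  have h1 : p * φ < Real.pi := by
    have := (lt_div_iff₀ (by linarith)).mp hφ.2
    linarith
  refine ⟨h0, h1, by nlinarith, by nlinarith, by nlinarith⟩

theorem raney_sin_pos {p φ : ℝ} (hp : 1 < p) (hφ : φ ∈ Ioo 0 (Real.pi / p)) :
    0 < Real.sin φ ∧ 0 < Real.sin (p * φ) ∧ 0 < Real.sin ((p - 1) * φ) := by
  obtain ⟨h0, h1, h2, h3, h4⟩ := raney_angle_bounds hp hφ
  exact ⟨Real.sin_pos_of_pos_of_lt_pi h0 h2,
    Real.sin_pos_of_pos_of_lt_pi (by nlinarith) h1, Real.sin_pos_of_pos_of_lt_pi h3 h4⟩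

theorem raneyRadius_pos {p φ : ℝ} (hp : 1 < p) (hφ : φ ∈ Ioo 0 (Real.pi / p)) :
    0 < raneyRadius p φ :=
  div_pos (raney_sin_pos hp hφ).2.1 (raney_sin_pos hp hφ).2.2

theorem raneyShift_pos {p φ : ℝ} (hp : 1 < p) (hφ : φ ∈ Ioo 0 (Real.pi / p)) :
    0 < raneyShift p φ :=
  div_pos (raney_sin_pos hp hφ).1 (raney_sin_pos hp hφ).2.2

theorem raneyAbscissa_pos {p φ : ℝ} (hp : 1 < p) (hφ : φ ∈ Ioo 0 (Real.pi / p)) :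
    0 < raneyAbscissa p φ :=
  div_pos (Real.rpow_pos_of_pos (raneyRadius_pos hp hφ) _) (raneyShift_pos hp hφ)

theorem raneyPoint_sub_one {p φ : ℝ} (hp : 1 < p) (hφ : φ ∈ Ioo 0 (Real.pi / p)) :
    raneyPoint p φ - 1 = raneyShift p φ * Complex.exp ((p * φ : ℝ) * Complex.I) := by
  have h := (raney_sin_pos hp hφ).2.2.ne'
  have hs : Real.sin ((p - 1) * φ) =
      Real.sin (p * φ) * Real.cos φ - Real.cos (p * φ) * Real.sin φ := by
    rw [← Real.sin_sub]
    congr 1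
    ring
  apply Complex.ext
  · simp only [raneyPoint, raneyShift, raneyRadius, Complex.sub_re, Complex.re_ofReal_mul,
      Complex.exp_ofReal_mul_I_re, Complex.one_re]
    rw [hs] at h ⊢
    field_simp
    ring
  · simp only [raneyPoint, raneyShift, raneyRadius, Complex.sub_im, Complex.im_ofReal_mul,
      Complex.exp_ofReal_mul_I_im, Complex.one_im]
    ring

theorem hasDerivAt_raneyRadius {p φ : ℝ} (hp : 1 < p) (hφ : φ ∈ Ioo 0 (Real.pi / p)) :
    HasDerivAt (raneyRadius p) (raneyRadius p φ * (p * (Real.cos (p * φ) / Real.sin (p * φ)) -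
      (p - 1) * (Real.cos ((p - 1) * φ) / Real.sin ((p - 1) * φ)))) φ := by
  obtain ⟨h1, h2, h3⟩ := raney_sin_pos hp hφ
  have d1 : HasDerivAt (fun φ => Real.sin (p * φ)) (Real.cos (p * φ) * p) φ := by
    simpa using ((hasDerivAt_id φ).const_mul p).sin
  have d2 : HasDerivAt (fun φ => Real.sin ((p - 1) * φ)) (Real.cos ((p - 1) * φ) * (p - 1)) φ := by
    simpa using ((hasDerivAt_id φ).const_mul (p - 1)).sin
  refine (d1.div d2 h3.ne').congr_deriv ?_
  simp only [raneyRadius]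
  generalize Real.sin ((p - 1) * φ) = a at *
  generalize Real.cos ((p - 1) * φ) = b at *
  field_simp

theorem hasDerivAt_raneyShift {p φ : ℝ} (hp : 1 < p) (hφ : φ ∈ Ioo 0 (Real.pi / p)) :
    HasDerivAt (raneyShift p) (raneyShift p φ * (Real.cos φ / Real.sin φ -
      (p - 1) * (Real.cos ((p - 1) * φ) / Real.sin ((p - 1) * φ)))) φ := by
  obtain ⟨h1, h2, h3⟩ := raney_sin_pos hp hφ
  have d2 : HasDerivAt (fun φ => Real.sin ((p - 1) * φ)) (Real.cos ((p - 1) * φ) * (p - 1)) φ := by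
    simpa using ((hasDerivAt_id φ).const_mul (p - 1)).sin
  refine ((Real.hasDerivAt_sin φ).div d2 h3.ne').congr_deriv ?_
  simp only [raneyShift]
  generalize Real.sin ((p - 1) * φ) = a at *
  generalize Real.cos ((p - 1) * φ) = b at *
  field_simp

/-- The logarithmic derivative of `raneyAbscissa p`. -/
def raneyLogDeriv (p φ : ℝ) : ℝ :=
  p ^ 2 * (Real.cos (p * φ) / Real.sin (p * φ)) - Real.cos φ / Real.sin φ -
    (p - 1) ^ 2 * (Real.cos ((p - 1) * φ) / Real.sin ((p - 1) * φ))

theorem hasDerivAt_raneyAbscissa {p φ : ℝ} (hp : 1 < p) (hφ : φ ∈ Ioo 0 (Real.pi / p)) :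
    HasDerivAt (raneyAbscissa p) (raneyAbscissa p φ * raneyLogDeriv p φ) φ := by
  have hR := raneyRadius_pos hp hφ
  have hS := raneyShift_pos hp hφ
  have h1 := ((hasDerivAt_raneyRadius hp hφ).rpow_const (p := p) (Or.inl hR.ne')).div
    (hasDerivAt_raneyShift hp hφ) hS.ne'
  refine h1.congr_deriv ?_
  rw [Real.rpow_sub_one hR.ne']
  simp only [raneyAbscissa, raneyLogDeriv]
  field_simp
  ring

/-- In terms of `X = cot φ` and `Y = cot ((p - 1) φ)` the logarithmic derivative is
`-((X - (p - 1) Y) ^ 2 + p ^ 2) / (X + Y)`. -/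
theorem raneyLogDeriv_neg {p φ : ℝ} (hp : 1 < p) (hφ : φ ∈ Ioo 0 (Real.pi / p)) :
    raneyLogDeriv p φ < 0 := by
  obtain ⟨h1, h2, h3⟩ := raney_sin_pos hp hφ
  have hs : Real.sin (p * φ) =
      Real.sin φ * Real.cos ((p - 1) * φ) + Real.cos φ * Real.sin ((p - 1) * φ) := by
    rw [← Real.sin_add]
    congr 1
    ring
  have hc : Real.cos (p * φ) =
      Real.cos φ * Real.cos ((p - 1) * φ) - Real.sin φ * Real.sin ((p - 1) * φ) := by
    rw [← Real.cos_add]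
    congr 1
    ring
  rw [hs] at h2
  simp only [raneyLogDeriv]
  rw [hs, hc]
  generalize Real.sin φ = a at *
  generalize Real.cos φ = a' at *
  generalize Real.sin ((p - 1) * φ) = b at *
  generalize Real.cos ((p - 1) * φ) = b' at *
  have key : p ^ 2 * ((a' * b' - a * b) / (a * b' + a' * b)) - a' / a - (p - 1) ^ 2 * (b' / b) =
      -(((a' * b - (p - 1) * (a * b')) ^ 2 + (p * (a * b)) ^ 2) / ((a * b' + a' * b) * (a * b))) := by
    obtain ⟨D, hD⟩ : ∃ D, D = a * b' + a' * b := ⟨_, rfl⟩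
    rw [← hD] at h2 ⊢
    obtain rfl : a' = (D - a * b') / b := by
      rw [hD]
      field_simp
      ring
    field_simp
    ring
  rw [key, neg_lt_zero]
  have : 0 < p * (a * b) := by positivity
  positivity

theorem continuousOn_raneyAbscissa {p : ℝ} (hp : 1 < p) :
    ContinuousOn (raneyAbscissa p) (Ioo 0 (Real.pi / p)) := fun _ hφ =>
  (hasDerivAt_raneyAbscissa hp hφ).continuousAt.continuousWithinAt

theorem strictAntiOn_raneyAbscissa {p : ℝ} (hp : 1 < p) :
    StrictAntiOn (raneyAbscissa p) (Ioo 0 (Real.pi / p)) := by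
  refine strictAntiOn_of_deriv_neg (convex_Ioo _ _) (continuousOn_raneyAbscissa hp) fun φ hφ => ?_
  rw [interior_Ioo] at hφ
  rw [(hasDerivAt_raneyAbscissa hp hφ).deriv]
  exact mul_neg_of_pos_of_neg (raneyAbscissa_pos hp hφ) (raneyLogDeriv_neg hp hφ)

theorem tendsto_sin_mul_div_zero (a : ℝ) :
    Tendsto (fun φ : ℝ => Real.sin (a * φ) / φ) (𝓝[>] 0) (𝓝 a) := by
  have d1 : HasDerivAt (fun φ => Real.sin (a * φ)) a 0 := by
    simpa using ((hasDerivAt_id (0 : ℝ)).const_mul a).sin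
  have := d1.tendsto_slope_zero_right
  refine this.congr fun t => ?_
  simp [div_eq_inv_mul]

theorem tendsto_raneyRadius_zero {p : ℝ} (hp : 1 < p) :
    Tendsto (raneyRadius p) (𝓝[>] 0) (𝓝 (p / (p - 1))) := by
  have := (tendsto_sin_mul_div_zero p).div (tendsto_sin_mul_div_zero (p - 1)) (by linarith)
  refine this.congr' ?_
  filter_upwards [self_mem_nhdsWithin] with φ hφ
  simp only [Pi.div_apply, raneyRadius]
  exact div_div_div_cancel_right₀ (ne_of_gt hφ) _ _

theorem tendsto_raneyShift_zero {p : ℝ} (hp : 1 < p) :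
    Tendsto (raneyShift p) (𝓝[>] 0) (𝓝 (1 / (p - 1))) := by
  have := (tendsto_sin_mul_div_zero 1).div (tendsto_sin_mul_div_zero (p - 1)) (by linarith)
  refine this.congr' ?_
  filter_upwards [self_mem_nhdsWithin] with φ hφ
  simp only [Pi.div_apply, raneyShift, one_mul]
  exact div_div_div_cancel_right₀ (ne_of_gt hφ) _ _

theorem raneyEndpoint_eq {p : ℝ} (hp : 1 < p) :
    raneyEndpoint p = (p / (p - 1)) ^ p / (1 / (p - 1)) := by
  have h : 0 < p - 1 := by linarith
  rw [raneyEndpoint, Real.div_rpow (by linarith) h.le, Real.rpow_sub h, Real.rpow_one]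
  field_simp

theorem raneyEndpoint_pos {p : ℝ} (hp : 1 < p) : 0 < raneyEndpoint p :=
  mul_pos (Real.rpow_pos_of_pos (by linarith) _) (Real.rpow_pos_of_pos (by linarith) _)

theorem tendsto_raneyAbscissa_zero {p : ℝ} (hp : 1 < p) :
    Tendsto (raneyAbscissa p) (𝓝[>] 0) (𝓝 (raneyEndpoint p)) := by
  have h : 0 < p - 1 := by linarith
  rw [raneyEndpoint_eq hp]
  exact ((tendsto_raneyRadius_zero hp).rpow_const (Or.inr (by linarith))).div
    (tendsto_raneyShift_zero hp) (by positivity)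

theorem sin_sub_one_mul_pi_div_pos {p : ℝ} (hp : 1 < p) :
    0 < Real.sin ((p - 1) * (Real.pi / p)) := by
  have hp0 : 0 < p := by linarith
  apply Real.sin_pos_of_pos_of_lt_pi
  · have := Real.pi_pos
    have : 0 < p - 1 := by linarith
    positivity
  · rw [← mul_div_assoc, div_lt_iff₀ hp0]
    nlinarith [Real.pi_pos]

theorem continuousAt_raneyRadius_pi_div {p : ℝ} (hp : 1 < p) :
    ContinuousAt (raneyRadius p) (Real.pi / p) := by
  refine ContinuousAt.div ?_ ?_ (sin_sub_one_mul_pi_div_pos hp).ne' <;> fun_prop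

theorem raneyRadius_pi_div {p : ℝ} (hp : 1 < p) : raneyRadius p (Real.pi / p) = 0 := by
  rw [raneyRadius, mul_div_cancel₀ _ (by linarith), Real.sin_pi, zero_div]

theorem tendsto_raneyRadius_pi_div {p : ℝ} (hp : 1 < p) :
    Tendsto (raneyRadius p) (𝓝[<] (Real.pi / p)) (𝓝 0) := by
  have := (continuousAt_raneyRadius_pi_div hp).tendsto
  rw [raneyRadius_pi_div hp] at this
  exact this.mono_left nhdsWithin_le_nhds

theorem tendsto_raneyAbscissa_pi_div {p : ℝ} (hp : 1 < p) :
    Tendsto (raneyAbscissa p) (𝓝[<] (Real.pi / p)) (𝓝 0) := by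
  have hp0 : 0 < p := by linarith
  have h1 : ContinuousAt (raneyShift p) (Real.pi / p) := by
    refine ContinuousAt.div ?_ ?_ (sin_sub_one_mul_pi_div_pos hp).ne' <;> fun_prop
  have h2 : raneyShift p (Real.pi / p) ≠ 0 := by
    refine (div_pos (Real.sin_pos_of_pos_of_lt_pi (by have := Real.pi_pos; positivity) ?_)
      (sin_sub_one_mul_pi_div_pos hp)).ne'
    exact div_lt_self Real.pi_pos hp
  have h3 := ((tendsto_raneyRadius_pi_div hp).rpow_const (p := p) (Or.inr hp0.le)).div
    (h1.tendsto.mono_left nhdsWithin_le_nhds) h2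
  rwa [Real.zero_rpow hp0.ne', zero_div] at h3

theorem image_raneyAbscissa {p : ℝ} (hp : 1 < p) :
    raneyAbscissa p '' Ioo 0 (Real.pi / p) = Ioo 0 (raneyEndpoint p) := by
  have hpos : 0 < Real.pi / p := div_pos Real.pi_pos (by linarith)
  have hI0 : Ioo 0 (Real.pi / p) ∈ 𝓝[>] (0 : ℝ) := Ioo_mem_nhdsGT hpos
  have hI1 : Ioo 0 (Real.pi / p) ∈ 𝓝[<] (Real.pi / p) := Ioo_mem_nhdsLT hpos
  apply Subset.antisymm
  · rintro _ ⟨φ, hφ, rfl⟩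
    refine ⟨raneyAbscissa_pos hp hφ, ?_⟩
    have hmid : φ / 2 ∈ Ioo 0 (Real.pi / p) := ⟨by linarith [hφ.1], by linarith [hφ.1, hφ.2]⟩
    refine lt_of_lt_of_le (strictAntiOn_raneyAbscissa hp hmid hφ (by linarith [hφ.1])) ?_
    refine ge_of_tendsto (tendsto_raneyAbscissa_zero hp) ?_
    filter_upwards [Ioo_mem_nhdsGT hmid.1] with θ hθ
    exact (strictAntiOn_raneyAbscissa hp ⟨hθ.1, hθ.2.trans hmid.2⟩ hmid hθ.2).le
  · exact isPreconnected_Ioo.intermediate_value_Ioo (le_principal_iff.mpr hI1)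
      (le_principal_iff.mpr hI0) (continuousOn_raneyAbscissa hp) (tendsto_raneyAbscissa_pi_div hp)
      (tendsto_raneyAbscissa_zero hp)

/-- The inverse of `raneyAbscissa p` on `(0, c(p))`; its values elsewhere are irrelevant. -/
def raneyAngle (p x : ℝ) : ℝ := Function.invFunOn (raneyAbscissa p) (Ioo 0 (Real.pi / p)) x

theorem raneyAngle_mem {p x : ℝ} (hp : 1 < p) (hx : x ∈ Ioo 0 (raneyEndpoint p)) :
    raneyAngle p x ∈ Ioo 0 (Real.pi / p) := by
  rw [← image_raneyAbscissa hp] at hx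
  exact Function.invFunOn_mem hx

theorem raneyAbscissa_raneyAngle {p x : ℝ} (hp : 1 < p) (hx : x ∈ Ioo 0 (raneyEndpoint p)) :
    raneyAbscissa p (raneyAngle p x) = x := by
  rw [← image_raneyAbscissa hp] at hx
  exact Function.invFunOn_eq hx

theorem raneyAbscissa_mem {p φ : ℝ} (hp : 1 < p) (hφ : φ ∈ Ioo 0 (Real.pi / p)) :
    raneyAbscissa p φ ∈ Ioo 0 (raneyEndpoint p) :=
  image_raneyAbscissa hp ▸ mem_image_of_mem _ hφ

theorem raneyAngle_raneyAbscissa {p φ : ℝ} (hp : 1 < p) (hφ : φ ∈ Ioo 0 (Real.pi / p)) :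
    raneyAngle p (raneyAbscissa p φ) = φ :=
  (strictAntiOn_raneyAbscissa hp).injOn (raneyAngle_mem hp (raneyAbscissa_mem hp hφ)) hφ
    (raneyAbscissa_raneyAngle hp (raneyAbscissa_mem hp hφ))

theorem continuousAt_raneyAngle {p x : ℝ} (hp : 1 < p) (hx : x ∈ Ioo 0 (raneyEndpoint p)) :
    ContinuousAt (raneyAngle p) x := by
  have hmono : MonotoneOn (fun x => -raneyAngle p x) (Ioo 0 (raneyEndpoint p)) := by
    intro a ha b hb hab
    simp only [neg_le_neg_iff]
    by_contra! h
    have := strictAntiOn_raneyAbscissa hp (raneyAngle_mem hp ha) (raneyAngle_mem hp hb) h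
    rw [raneyAbscissa_raneyAngle hp ha, raneyAbscissa_raneyAngle hp hb] at this
    linarith
  have himg : Ioo (-(Real.pi / p)) 0 ⊆
      (fun x => -raneyAngle p x) '' Ioo 0 (raneyEndpoint p) := by
    intro y hy
    have hy' : -y ∈ Ioo 0 (Real.pi / p) := ⟨by linarith [hy.2], by linarith [hy.1]⟩
    refine ⟨raneyAbscissa p (-y), raneyAbscissa_mem hp hy', ?_⟩
    simp only [raneyAngle_raneyAbscissa hp hy', neg_neg]
  have hm := raneyAngle_mem hp hx
  have := continuousAt_of_monotoneOn_of_image_mem_nhds hmono (Ioo_mem_nhds hx.1 hx.2)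
    (mem_of_superset (Ioo_mem_nhds (by linarith [hm.2]) (by linarith [hm.1])) himg)
  simpa only [neg_neg] using this.fun_neg

theorem raneyShift_le {p φ : ℝ} (hp : 1 < p) (hφ : φ ∈ Ioo 0 (Real.pi / p)) :
    raneyShift p φ ≤ max 1 (Real.pi / (2 * (p - 1))) := by
  obtain ⟨h0, h1, h2, h3, h4⟩ := raney_angle_bounds hp hφ
  obtain ⟨s1, s2, s3⟩ := raney_sin_pos hp hφ
  have hq : 0 < p - 1 := by linarith
  rw [raneyShift, div_le_iff₀ s3]
  have hpi := Real.pi_pos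
  rcases le_total ((p - 1) * φ) (Real.pi / 2) with h | h
  · have e1 := Real.mul_le_sin h3.le h
    have e2 := Real.sin_le h0.le
    calc Real.sin φ ≤ φ := e2
      _ = Real.pi / (2 * (p - 1)) * (2 / Real.pi * ((p - 1) * φ)) := by field_simp
      _ ≤ max 1 (Real.pi / (2 * (p - 1))) * Real.sin ((p - 1) * φ) := by
        refine mul_le_mul (le_max_right _ _) e1 (by positivity) (by positivity)
  -- here `φ ≤ π - (p - 1) φ ≤ π / 2`, and the sine is increasing on `[0, π / 2]`
  · have e1 : Real.sin φ ≤ Real.sin (Real.pi - (p - 1) * φ) :=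
      Real.sin_le_sin_of_le_of_le_pi_div_two (by linarith) (by linarith) (by linarith)
    rw [Real.sin_pi_sub] at e1
    exact e1.trans (le_mul_of_one_le_left s3.le (le_max_left _ _))

/-! ### The density -/

/-- The function `x ↦ x W(x)`, where `W` is the density: at the point `B` of the curve with
abscissa `x` it is `Im (B ^ r) / π`. It is extended by `0` outside `(0, c(p))`. -/
def raneyProfile (p r x : ℝ) : ℝ :=
  (Ioo 0 (raneyEndpoint p)).indicator (fun x =>
    raneyRadius p (raneyAngle p x) ^ r * Real.sin (r * raneyAngle p x) / Real.pi) x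

theorem raneyProfile_of_notMem {p r x : ℝ} (hx : x ∉ Ioo 0 (raneyEndpoint p)) :
    raneyProfile p r x = 0 := indicator_of_notMem hx _

theorem raneyProfile_raneyAbscissa {p r φ : ℝ} (hp : 1 < p) (hφ : φ ∈ Ioo 0 (Real.pi / p)) :
    raneyProfile p r (raneyAbscissa p φ) = raneyRadius p φ ^ r * Real.sin (r * φ) / Real.pi := by
  rw [raneyProfile, indicator_of_mem (raneyAbscissa_mem hp hφ), raneyAngle_raneyAbscissa hp hφ]

theorem raneyProfile_nonneg {p r : ℝ} (hp : 1 < p) (hr : 0 < r) (hrp : r ≤ p) (x : ℝ) :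
    0 ≤ raneyProfile p r x := by
  refine indicator_nonneg (fun x hx => ?_) x
  have hm := raneyAngle_mem hp hx
  obtain ⟨h0, h1, -⟩ := raney_angle_bounds hp hm
  have := (raneyRadius_pos hp hm).le
  have : 0 ≤ Real.sin (r * raneyAngle p x) :=
    Real.sin_nonneg_of_nonneg_of_le_pi (by positivity) (by nlinarith)
  have := Real.pi_pos
  positivity

theorem continuousAt_raneyProfile {p r x : ℝ} (hp : 1 < p) (hx : x ∈ Ioo 0 (raneyEndpoint p)) :
    ContinuousAt (raneyProfile p r) x := by
  have hm := raneyAngle_mem hp hx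
  have hc := continuousAt_raneyAngle hp hx
  have hR : ContinuousAt (fun x => raneyRadius p (raneyAngle p x)) x :=
    ContinuousAt.comp (f := raneyAngle p) (hasDerivAt_raneyRadius hp hm).continuousAt hc
  have : ContinuousAt (fun x => raneyRadius p (raneyAngle p x) ^ r *
      Real.sin (r * raneyAngle p x) / Real.pi) x := by
    refine ((hR.rpow_const (Or.inl (raneyRadius_pos hp hm).ne')).mul ?_).div_const _
    exact Real.continuous_sin.continuousAt.comp (hc.const_mul r)
  refine this.congr ?_
  filter_upwards [Ioo_mem_nhds hx.1 hx.2] with y hy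
  rw [raneyProfile, indicator_of_mem hy]

theorem measurable_raneyProfile {p : ℝ} (hp : 1 < p) (r : ℝ) : Measurable (raneyProfile p r) := by
  have h : ContinuousOn (raneyProfile p r) (Ioo 0 (raneyEndpoint p)) := fun x hx =>
    (continuousAt_raneyProfile hp hx).continuousWithinAt
  have h2 : raneyProfile p r = (Ioo 0 (raneyEndpoint p)).piecewise (raneyProfile p r) 0 := by
    ext x
    by_cases hx : x ∈ Ioo 0 (raneyEndpoint p)
    · rw [piecewise_eq_of_mem _ _ _ hx]
    · rw [piecewise_eq_of_notMem _ _ _ hx, raneyProfile_of_notMem hx]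
      rfl
  rw [h2]
  exact h.measurable_piecewise continuousOn_const measurableSet_Ioo

/-- On the curve `|B| ^ p = x |B - 1|`, and `|B - 1|` is bounded. -/
theorem exists_raneyProfile_le {p r : ℝ} (hp : 1 < p) (hr : 0 < r) :
    ∃ C : ℝ, 0 ≤ C ∧ ∀ x : ℝ, 0 < x → raneyProfile p r x ≤ C * x ^ (r / p) := by
  refine ⟨max 1 (Real.pi / (2 * (p - 1))) ^ (r / p), by positivity, fun x hx0 => ?_⟩
  by_cases hx : x ∈ Ioo 0 (raneyEndpoint p)
  swap
  · rw [raneyProfile_of_notMem hx]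
    positivity
  have hm := raneyAngle_mem hp hx
  have hR := raneyRadius_pos hp hm
  have hS := raneyShift_pos hp hm
  have hp0 : 0 < p := by linarith
  have h1 : raneyRadius p (raneyAngle p x) ^ p = raneyShift p (raneyAngle p x) * x := by
    nth_rw 3 [← raneyAbscissa_raneyAngle hp hx]
    rw [raneyAbscissa, mul_div_cancel₀ _ hS.ne']
  have h2 : raneyRadius p (raneyAngle p x) ^ r =
      raneyShift p (raneyAngle p x) ^ (r / p) * x ^ (r / p) := by
    rw [← Real.mul_rpow hS.le hx0.le, ← h1, ← Real.rpow_mul hR.le, mul_div_cancel₀ _ hp0.ne']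
  rw [raneyProfile, indicator_of_mem hx]
  have h3 : raneyRadius p (raneyAngle p x) ^ r * Real.sin (r * raneyAngle p x) ≤
      raneyRadius p (raneyAngle p x) ^ r :=
    mul_le_of_le_one_right (by positivity) (Real.sin_le_one _)
  have h4 : (1 : ℝ) ≤ Real.pi := by linarith [Real.two_le_pi]
  calc _ ≤ raneyRadius p (raneyAngle p x) ^ r / Real.pi := by gcongr
    _ ≤ raneyRadius p (raneyAngle p x) ^ r := div_le_self (by positivity) h4
    _ = _ := h2
    _ ≤ _ := by
      gcongr
      exact raneyShift_le hp hm

/-! ### A primitive of `B ^ (a - 1) (B - 1) ^ (-u)` on the upper half-plane -/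

/-- The power `w ^ (-u)`, written so that its continuity on the closed upper half-plane without
the origin is that of the principal branch on the slit plane. -/
def upperPow (u : ℝ) (w : ℂ) : ℂ :=
  Complex.exp (-(Real.pi * u / 2 : ℝ) * Complex.I) * (-Complex.I * w) ^ (-u : ℂ)

theorem ofReal_mul_exp_cpow {x θ : ℝ} (hx : 0 < x) (h1 : -Real.pi < θ) (h2 : θ ≤ Real.pi) (c : ℝ) :
    ((x : ℂ) * Complex.exp (θ * Complex.I)) ^ (c : ℂ) =
      ((x ^ c : ℝ) : ℂ) * Complex.exp ((c * θ : ℝ) * Complex.I) := by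
  have hx' : (x : ℂ) ≠ 0 := by exact_mod_cast hx.ne'
  rw [Complex.cpow_def_of_ne_zero (mul_ne_zero hx' (Complex.exp_ne_zero _)),
    Complex.log_ofReal_mul hx (Complex.exp_ne_zero _), Complex.log_exp (by simpa using h1)
      (by simpa using h2), add_mul, Complex.exp_add, Real.rpow_def_of_pos hx]
  push_cast
  congr 2
  ring

theorem upperPow_ofReal_mul_exp {x θ : ℝ} (hx : 0 < x) (h1 : 0 ≤ θ) (h2 : θ ≤ Real.pi) (u : ℝ) :
    upperPow u ((x : ℂ) * Complex.exp (θ * Complex.I)) =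
      ((x ^ (-u) : ℝ) : ℂ) * Complex.exp ((-u * θ : ℝ) * Complex.I) := by
  have hpi := Real.pi_pos
  have h : -Complex.I * ((x : ℂ) * Complex.exp (θ * Complex.I)) =
      (x : ℂ) * Complex.exp ((θ - Real.pi / 2 : ℝ) * Complex.I) := by
    push_cast
    rw [sub_mul, Complex.exp_sub, Complex.exp_pi_div_two_mul_I, div_eq_mul_inv, Complex.inv_I]
    ring
  rw [upperPow, h, ← Complex.ofReal_neg u, ofReal_mul_exp_cpow hx (by linarith) (by linarith),
    mul_left_comm, ← Complex.exp_add]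
  congr 2
  push_cast
  ring

theorem norm_upperPow (u : ℝ) (w : ℂ) : ‖upperPow u w‖ = ‖w‖ ^ (-u) := by
  rw [upperPow, norm_mul, ← Complex.ofReal_neg, Complex.norm_exp_ofReal_mul_I, one_mul,
    ← Complex.ofReal_neg, Complex.norm_cpow_real, norm_mul, norm_neg, Complex.norm_I, one_mul]

theorem neg_I_mul_mem_slitPlane {w : ℂ} (h : 0 < w.im ∨ w.re ≠ 0) :
    -Complex.I * w ∈ Complex.slitPlane := by
  rw [Complex.mem_slitPlane_iff]
  simpa using h

theorem continuousAt_upperPow (u : ℝ) {w : ℂ} (h : 0 < w.im ∨ w.re ≠ 0) :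
    ContinuousAt (upperPow u) w := by
  unfold upperPow
  refine continuousAt_const.mul ?_
  exact ContinuousAt.comp (f := fun w : ℂ => -Complex.I * w) (g := fun w : ℂ => w ^ (-u : ℂ))
    (continuousAt_cpow_const (neg_I_mul_mem_slitPlane h)) (by fun_prop)

theorem measurable_upperPow (u : ℝ) : Measurable (upperPow u) := by
  unfold upperPow
  fun_prop

/-- The derivative of `upperPow u`. -/
def upperPowDeriv (u : ℝ) (w : ℂ) : ℂ :=
  Complex.exp (-(Real.pi * u / 2 : ℝ) * Complex.I) *
    ((-u : ℂ) * (-Complex.I * w) ^ (-u - 1 : ℂ) * (-Complex.I))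

theorem hasDerivAt_upperPow (u : ℝ) {w : ℂ} (h : 0 < w.im ∨ w.re ≠ 0) :
    HasDerivAt (upperPow u) (upperPowDeriv u w) w := by
  have h1 : HasDerivAt (fun w : ℂ => -Complex.I * w) (-Complex.I) w := by
    simpa using (hasDerivAt_id w).const_mul (-Complex.I)
  exact (h1.cpow_const (neg_I_mul_mem_slitPlane h)).const_mul _

theorem norm_upperPowDeriv {u : ℝ} (hu : 0 ≤ u) (w : ℂ) :
    ‖upperPowDeriv u w‖ = u * ‖w‖ ^ (-u - 1) := by
  have h : (-u - 1 : ℂ) = ((-u - 1 : ℝ) : ℂ) := by push_cast; ring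
  rw [upperPowDeriv, norm_mul, ← Complex.ofReal_neg, Complex.norm_exp_ofReal_mul_I, one_mul, h,
    norm_mul, norm_mul, Complex.norm_cpow_real, norm_mul, norm_neg, norm_neg, Complex.norm_I,
    one_mul, mul_one, Complex.norm_real, Real.norm_of_nonneg hu]

theorem measurable_upperPowDeriv (u : ℝ) : Measurable (upperPowDeriv u) := by
  unfold upperPowDeriv
  fun_prop

/-- The left side is the distance from `1` to the line through `0` and `B`. -/
theorem im_div_norm_le_norm_mul_sub_one {B : ℂ} (t : ℝ) (hB : 0 < B.im) :
    B.im / ‖B‖ ≤ ‖(t : ℂ) * B - 1‖ := by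
  have hB0 : 0 < ‖B‖ := norm_pos_iff.mpr fun h => by simp [h] at hB
  rw [div_le_iff₀ hB0, ← Complex.norm_conj B, ← norm_mul]
  have h : (((t : ℂ) * B - 1) * (starRingEnd ℂ) B).im = B.im := by
    simp only [Complex.mul_im, Complex.sub_re, Complex.sub_im, Complex.conj_re, Complex.conj_im,
      Complex.mul_re, Complex.ofReal_re, Complex.ofReal_im, Complex.one_re, Complex.one_im]
    ring
  calc B.im = |B.im| := (abs_of_pos hB).symm
    _ ≤ _ := by
      rw [← h]
      exact Complex.abs_im_le_norm _

theorem mul_sub_one_mem {B : ℂ} {t : ℝ} (ht : 0 ≤ t) (hB : 0 < B.im) :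
    0 < ((t : ℂ) * B - 1).im ∨ ((t : ℂ) * B - 1).re ≠ 0 := by
  rcases ht.eq_or_lt with rfl | ht
  · right; simp
  · left; simpa using mul_pos ht hB

/-- The integral `∫₀¹ t ^ (a - 1) (t B - 1) ^ (-u) dt`. -/
def segmentIntegral (a u : ℝ) (B : ℂ) : ℂ :=
  ∫ t in (0 : ℝ)..1, ((t ^ (a - 1) : ℝ) : ℂ) * upperPow u ((t : ℂ) * B - 1)

theorem hasDerivAt_segmentIntegral {a u : ℝ} (ha : 0 < a) (hu : 0 ≤ u) {B : ℂ} (hB : 0 < B.im) :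
    (IntervalIntegrable (fun t : ℝ => ((t ^ (a - 1) : ℝ) : ℂ) * upperPow u ((t : ℂ) * B - 1))
      volume 0 1 ∧
    IntervalIntegrable (fun t : ℝ => ((t ^ (a - 1) : ℝ) : ℂ) *
      (upperPowDeriv u ((t : ℂ) * B - 1) * t)) volume 0 1) ∧
    HasDerivAt (segmentIntegral a u) (∫ t in (0 : ℝ)..1, ((t ^ (a - 1) : ℝ) : ℂ) *
      (upperPowDeriv u ((t : ℂ) * B - 1) * t)) B := by
  have hB0 : 0 < ‖B‖ := norm_pos_iff.mpr fun h => by simp [h] at hB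
  have hrpow : IntervalIntegrable (fun t : ℝ => t ^ (a - 1)) volume 0 1 :=
    intervalIntegral.intervalIntegrable_rpow' (by linarith)
  have hmeas : ∀ B : ℂ, AEStronglyMeasurable
      (fun t : ℝ => ((t ^ (a - 1) : ℝ) : ℂ) * upperPow u ((t : ℂ) * B - 1))
      (volume.restrict (uIoc (0 : ℝ) 1)) := fun B => by
    have := (measurable_upperPow u).comp (show Measurable fun t : ℝ => (t : ℂ) * B - 1 by fun_prop)
    exact (Measurable.mul (by fun_prop) this).aestronglyMeasurable
  have hint : IntervalIntegrable
      (fun t : ℝ => ((t ^ (a - 1) : ℝ) : ℂ) * upperPow u ((t : ℂ) * B - 1)) volume 0 1 := by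
    refine (hrpow.mul_const ((B.im / ‖B‖) ^ (-u))).mono_fun' (hmeas B) ?_
    refine (ae_restrict_iff' measurableSet_uIoc).mpr (Eventually.of_forall fun t ht => ?_)
    rw [uIoc_of_le zero_le_one] at ht
    simp only
    rw [norm_mul, Complex.norm_real, Real.norm_of_nonneg (Real.rpow_nonneg ht.1.le _),
      norm_upperPow]
    refine mul_le_mul_of_nonneg_left ?_ (Real.rpow_nonneg ht.1.le _)
    exact Real.rpow_le_rpow_of_nonpos (div_pos hB hB0)
      (im_div_norm_le_norm_mul_sub_one t hB) (by linarith)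
  set η : ℝ := B.im / 2 with hη
  have hη0 : 0 < η := by positivity
  have hball : ∀ B' ∈ Metric.ball B η, η ≤ B'.im ∧ ‖B'‖ ≤ ‖B‖ + η := by
    intro B' hB'
    rw [Metric.mem_ball, dist_eq_norm] at hB'
    constructor
    · have := Complex.abs_im_le_norm (B' - B)
      rw [Complex.sub_im] at this
      have := (abs_le.mp (this.trans hB'.le)).1
      linarith
    · have := norm_add_le (B' - B) B
      rw [sub_add_cancel] at this
      linarith
  have key := intervalIntegral.hasDerivAt_integral_of_dominated_loc_of_deriv_le
    (μ := volume) (a := 0) (b := 1) (x₀ := B) (s := Metric.ball B η)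
    (F := fun B (t : ℝ) => ((t ^ (a - 1) : ℝ) : ℂ) * upperPow u ((t : ℂ) * B - 1))
    (F' := fun B (t : ℝ) => ((t ^ (a - 1) : ℝ) : ℂ) * (upperPowDeriv u ((t : ℂ) * B - 1) * t))
    (bound := fun t => t ^ (a - 1) * (u * (η / (‖B‖ + η)) ^ (-u - 1)))
    (Metric.ball_mem_nhds B hη0) (Eventually.of_forall hmeas) hint
    (by
      have := (measurable_upperPowDeriv u).comp
        (show Measurable fun t : ℝ => (t : ℂ) * B - 1 by fun_prop)
      have h2 : Measurable fun t : ℝ => upperPowDeriv u ((t : ℂ) * B - 1) * t :=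
        this.mul (by fun_prop)
      exact (Measurable.mul (by fun_prop) h2).aestronglyMeasurable)
    (by
      refine Eventually.of_forall fun t ht B' hB' => ?_
      rw [uIoc_of_le zero_le_one] at ht
      obtain ⟨b1, b2⟩ := hball B' hB'
      have hB'im : 0 < B'.im := by linarith
      have hB'0 : 0 < ‖B'‖ := norm_pos_iff.mpr fun h => by simp [h] at hB'im
      rw [norm_mul, Complex.norm_real, Real.norm_of_nonneg (Real.rpow_nonneg ht.1.le _),
        norm_mul, norm_upperPowDeriv hu, Complex.norm_real, Real.norm_of_nonneg ht.1.le]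
      refine mul_le_mul_of_nonneg_left ?_ (Real.rpow_nonneg ht.1.le _)
      have h1 : η / (‖B‖ + η) ≤ ‖(t : ℂ) * B' - 1‖ :=
        (div_le_div₀ hB'im.le b1 hB'0 b2).trans (im_div_norm_le_norm_mul_sub_one t hB'im)
      have h2 := Real.rpow_le_rpow_of_nonpos (z := -u - 1) (by positivity) h1 (by linarith)
      calc _ ≤ u * ‖(t : ℂ) * B' - 1‖ ^ (-u - 1) * 1 :=
            mul_le_mul_of_nonneg_left ht.2 (by positivity)
        _ ≤ _ := by rw [mul_one]; gcongr)
    (hrpow.mul_const _)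
    (by
      refine Eventually.of_forall fun t ht B' hB' => ?_
      rw [uIoc_of_le zero_le_one] at ht
      have hB'im : 0 < B'.im := by linarith [(hball B' hB').1]
      have h1 : HasDerivAt (fun B : ℂ => (t : ℂ) * B - 1) (t : ℂ) B' := by
        simpa using ((hasDerivAt_id B').const_mul (t : ℂ)).sub_const 1
      exact (((hasDerivAt_upperPow u (mul_sub_one_mem ht.1.le hB'im)).comp B' h1)).const_mul _)
  exact ⟨⟨hint, key.1⟩, key.2⟩

/-- The primitive `∫₀^B b ^ (a - 1) (b - 1) ^ (-u) db`, along the segment from `0` to `B`. -/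
def raneyPrimitive (a u : ℝ) (B : ℂ) : ℂ := B ^ (a : ℂ) * segmentIntegral a u B

theorem hasDerivAt_raneyPrimitive {a u : ℝ} (ha : 0 < a) (hu : 0 ≤ u) {B : ℂ} (hB : 0 < B.im) :
    HasDerivAt (raneyPrimitive a u) (B ^ (a - 1 : ℂ) * upperPow u (B - 1)) B := by
  obtain ⟨⟨hi1, hi2⟩, hd⟩ := hasDerivAt_segmentIntegral ha hu hB
  have hB0 : B ≠ 0 := fun h => by simp [h] at hB
  have hslit : B ∈ Complex.slitPlane := Or.inr hB.ne'
  have hpow : HasDerivAt (fun B : ℂ => B ^ (a : ℂ)) ((a : ℂ) * B ^ (a - 1 : ℂ)) B := by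
    simpa using (hasDerivAt_id B).cpow_const (c := (a : ℂ)) hslit
  refine (hpow.mul hd).congr_deriv ?_
  -- `d/dt (t ^ a (t B - 1) ^ (-u))` is the combination of the two integrands
  have hFTC : ∫ t in (0 : ℝ)..1, ((a : ℂ) * (((t ^ (a - 1) : ℝ) : ℂ) * upperPow u ((t : ℂ) * B - 1))
      + B * (((t ^ (a - 1) : ℝ) : ℂ) * (upperPowDeriv u ((t : ℂ) * B - 1) * t))) =
      upperPow u (B - 1) := by
    have hlin : ∀ t : ℝ, HasDerivAt (fun t : ℝ => (t : ℂ) * B - 1) B t := fun t => by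
      simpa using ((Complex.ofRealCLM.hasDerivAt (x := t)).mul_const B).sub_const 1
    have := intervalIntegral.integral_eq_sub_of_hasDerivAt_of_le zero_le_one
      (f := fun t : ℝ => ((t ^ a : ℝ) : ℂ) * upperPow u ((t : ℂ) * B - 1))
      (f' := fun t : ℝ => (a : ℂ) * (((t ^ (a - 1) : ℝ) : ℂ) * upperPow u ((t : ℂ) * B - 1))
      + B * (((t ^ (a - 1) : ℝ) : ℂ) * (upperPowDeriv u ((t : ℂ) * B - 1) * t)))
      (by
        intro t ht
        refine ContinuousAt.continuousWithinAt (ContinuousAt.mul ?_ ?_)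
        · exact Complex.continuous_ofReal.continuousAt.comp
            (Real.continuousAt_rpow_const _ _ (Or.inr ha.le))
        · exact ContinuousAt.comp (f := fun t : ℝ => (t : ℂ) * B - 1)
            (continuousAt_upperPow u (mul_sub_one_mem ht.1 hB)) (hlin t).continuousAt)
      (by
        intro t ht
        have h1 : HasDerivAt (fun t : ℝ => ((t ^ a : ℝ) : ℂ)) ((a * t ^ (a - 1) : ℝ) : ℂ) t :=
          (Real.hasDerivAt_rpow_const (Or.inl ht.1.ne')).ofReal_comp
        have h2 := (hasDerivAt_upperPow u (mul_sub_one_mem ht.1.le hB)).comp t (hlin t)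
        refine (h1.mul h2).congr_deriv ?_
        have h3 : t ^ a = t ^ (a - 1) * t := by
          rw [← Real.rpow_add_one ht.1.ne', sub_add_cancel]
        simp only [Function.comp]
        rw [h3]
        push_cast
        ring)
      ((hi1.const_mul _).add (hi2.const_mul _))
    rw [this]
    simp [Real.zero_rpow ha.ne']
  rw [intervalIntegral.integral_add (hi1.const_mul _) (hi2.const_mul _),
    intervalIntegral.integral_const_mul, intervalIntegral.integral_const_mul] at hFTC
  rw [← hFTC]
  have hBa : B ^ (a : ℂ) = B ^ (a - 1 : ℂ) * B := by
    rw [Complex.cpow_sub _ _ hB0, Complex.cpow_one, div_mul_cancel₀ _ hB0]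
  rw [hBa, segmentIntegral]
  ring

/-- The primitive in polar coordinates. -/
theorem raneyPrimitive_polar {a R φ : ℝ} (u : ℝ) (hR : 0 < R) (h0 : -Real.pi < φ)
    (h1 : φ ≤ Real.pi) :
    raneyPrimitive a u (R * Complex.exp (φ * Complex.I)) =
      Complex.exp ((a * φ : ℝ) * Complex.I) * ∫ y in (0 : ℝ)..R,
        ((y ^ (a - 1) : ℝ) : ℂ) * upperPow u ((y : ℂ) * Complex.exp (φ * Complex.I) - 1) := by
  have hR' : (R : ℂ) ≠ 0 := by exact_mod_cast hR.ne'
  have hs := intervalIntegral.integral_comp_mul_left (a := 0) (b := 1) (c := R)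
    (fun y : ℝ => ((y ^ (a - 1) : ℝ) : ℂ) * upperPow u ((y : ℂ) * Complex.exp (φ * Complex.I) - 1))
    hR.ne'
  rw [mul_zero, mul_one, Complex.real_smul, Complex.ofReal_inv] at hs
  have h2 : ∫ t in (0 : ℝ)..1, ((((R * t) ^ (a - 1) : ℝ) : ℂ) *
      upperPow u (((R * t : ℝ) : ℂ) * Complex.exp (φ * Complex.I) - 1)) =
      ((R ^ (a - 1) : ℝ) : ℂ) * segmentIntegral a u (R * Complex.exp (φ * Complex.I)) := by
    rw [segmentIntegral, ← intervalIntegral.integral_const_mul]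
    refine intervalIntegral.integral_congr fun t ht => ?_
    rw [uIcc_of_le zero_le_one] at ht
    rw [Real.mul_rpow hR.le ht.1]
    push_cast
    ring_nf
  rw [h2] at hs
  have h3 : R ^ a = R ^ (a - 1) * R := by rw [← Real.rpow_add_one hR.ne', sub_add_cancel]
  rw [raneyPrimitive, ofReal_mul_exp_cpow hR h0 h1, h3]
  rw [eq_inv_mul_iff_mul_eq₀ hR'] at hs
  rw [← hs]
  push_cast
  ring

theorem intervalIntegrable_rpow_mul_abs_sub_one_rpow {a u K : ℝ} (ha : 0 < a) (hu0 : 0 ≤ u)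
    (hu1 : u < 1) (hK : 0 ≤ K) :
    IntervalIntegrable (fun y : ℝ => y ^ (a - 1) * |y - 1| ^ (-u)) volume 0 K := by
  have h1 : IntervalIntegrable (fun y : ℝ => y ^ (a - 1)) volume 0 K :=
    intervalIntegral.intervalIntegrable_rpow' (by linarith)
  have h2 : IntervalIntegrable (fun y : ℝ => |y - 1| ^ (-u)) volume 0 K := by
    have := (intervalIntegral.intervalIntegrable_cpow' (a := 0 - 1) (b := K - 1)
      (r := ((-u : ℝ) : ℂ)) (by simpa using hu1)).norm
    simp_rw [Complex.norm_cpow_real, Complex.norm_real, Real.norm_eq_abs] at this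
    simpa using this.comp_sub_right 1
  refine ((h1.const_mul ((1 / 2 : ℝ) ^ (-u))).add
    (h2.const_mul ((1 / 2 : ℝ) ^ (a - 1) + (K + 1) ^ (a - 1)))).mono_fun' ?_ ?_
  · exact Measurable.aestronglyMeasurable (by fun_prop)
  refine (ae_restrict_iff' measurableSet_uIoc).mpr (Eventually.of_forall fun y hy => ?_)
  rw [uIoc_of_le hK] at hy
  have e1 : 0 ≤ y ^ (a - 1) := Real.rpow_nonneg hy.1.le _
  have e2 : 0 ≤ |y - 1| ^ (-u) := Real.rpow_nonneg (abs_nonneg _) _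
  have e3 : (0 : ℝ) ≤ (1 / 2 : ℝ) ^ (-u) := by positivity
  have e4 : (0 : ℝ) ≤ (1 / 2 : ℝ) ^ (a - 1) := by positivity
  have e5 : (0 : ℝ) ≤ (K + 1) ^ (a - 1) := by positivity
  simp only
  rw [Real.norm_of_nonneg (mul_nonneg e1 e2)]
  rcases le_total y (1 / 2) with h | h
  · have : |y - 1| ^ (-u) ≤ (1 / 2 : ℝ) ^ (-u) := by
      refine Real.rpow_le_rpow_of_nonpos (by norm_num) ?_ (by linarith)
      rw [abs_of_nonpos (by linarith)]
      linarith
    nlinarith [mul_nonneg (add_nonneg e4 e5) e2, mul_le_mul_of_nonneg_left this e1]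
  · have : y ^ (a - 1) ≤ (1 / 2 : ℝ) ^ (a - 1) + (K + 1) ^ (a - 1) := by
      rcases le_total 0 (a - 1) with h' | h'
      · have := Real.rpow_le_rpow hy.1.le (show y ≤ K + 1 by linarith [hy.2]) h'
        linarith
      · have := Real.rpow_le_rpow_of_nonpos (by norm_num) h h'
        linarith
    nlinarith [mul_nonneg e3 e1, mul_le_mul_of_nonneg_right this e2]

/-- The primitive extends continuously to the closed upper half-plane, also along curves: the
integrands are dominated by `y ^ (a - 1) |y - 1| ^ (-u)`. -/
theorem tendsto_raneyPrimitive {a u : ℝ} (ha : 0 < a) (hu0 : 0 ≤ u) (hu1 : u < 1)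
    {l : Filter ℝ} [l.IsCountablyGenerated] {R : ℝ → ℝ} {φ₀ R₀ : ℝ} (hφ : Tendsto id l (𝓝 φ₀))
    (hφ₀ : 0 ≤ φ₀) (hφ₁ : φ₀ < Real.pi) (hφl : ∀ᶠ φ in l, φ ∈ Ioo 0 Real.pi)
    (hR : Tendsto R l (𝓝 R₀)) (hRpos : ∀ᶠ φ in l, 0 < R φ) (hR₀ : 0 ≤ R₀) :
    Tendsto (fun φ => raneyPrimitive a u (R φ * Complex.exp (φ * Complex.I))) l
      (𝓝 (Complex.exp ((a * φ₀ : ℝ) * Complex.I) * ∫ y in (0 : ℝ)..R₀,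
        ((y ^ (a - 1) : ℝ) : ℂ) * upperPow u ((y : ℂ) * Complex.exp (φ₀ * Complex.I) - 1))) := by
  set F : ℝ → ℝ → ℂ := fun φ y => (Ioc 0 (R φ)).indicator (fun y : ℝ =>
    ((y ^ (a - 1) : ℝ) : ℂ) * upperPow u ((y : ℂ) * Complex.exp (φ * Complex.I) - 1)) y with hF
  have hFint : ∀ φ : ℝ, 0 ≤ R φ → R φ ≤ R₀ + 1 → ∫ y in (0 : ℝ)..R φ,
      ((y ^ (a - 1) : ℝ) : ℂ) * upperPow u ((y : ℂ) * Complex.exp (φ * Complex.I) - 1) =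
      ∫ y in Ioc 0 (R₀ + 1), F φ y := by
    intro φ h1 h2
    rw [intervalIntegral.integral_of_le h1, hF]
    simp only
    rw [setIntegral_indicator measurableSet_Ioc, inter_eq_self_of_subset_right
      (Ioc_subset_Ioc_right h2)]
  set f₀ : ℝ → ℂ := (Ioc 0 R₀).indicator (fun y : ℝ =>
    ((y ^ (a - 1) : ℝ) : ℂ) * upperPow u ((y : ℂ) * Complex.exp (φ₀ * Complex.I) - 1)) with hf₀
  have hf₀int : ∫ y in (0 : ℝ)..R₀,
      ((y ^ (a - 1) : ℝ) : ℂ) * upperPow u ((y : ℂ) * Complex.exp (φ₀ * Complex.I) - 1) =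
      ∫ y in Ioc 0 (R₀ + 1), f₀ y := by
    rw [intervalIntegral.integral_of_le hR₀, hf₀,
      setIntegral_indicator measurableSet_Ioc, inter_eq_self_of_subset_right
      (Ioc_subset_Ioc_right (by linarith))]
  have hlim : Tendsto (fun φ => ∫ y in Ioc 0 (R₀ + 1), F φ y) l
      (𝓝 (∫ y in Ioc 0 (R₀ + 1), f₀ y)) := by
    refine tendsto_integral_filter_of_dominated_convergence
      (fun y => y ^ (a - 1) * |y - 1| ^ (-u)) ?_ ?_ ?_ ?_
    · refine Eventually.of_forall fun φ => ?_
      have := (measurable_upperPow u).comp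
        (show Measurable fun y : ℝ => (y : ℂ) * Complex.exp (φ * Complex.I) - 1 by fun_prop)
      have h2 : Measurable fun y : ℝ => ((y ^ (a - 1) : ℝ) : ℂ) *
          upperPow u ((y : ℂ) * Complex.exp (φ * Complex.I) - 1) := Measurable.mul (by fun_prop) this
      exact (h2.indicator measurableSet_Ioc).aestronglyMeasurable
    · filter_upwards [hφl] with φ hφ
      refine (ae_restrict_iff' measurableSet_Ioc).mpr ?_
      have h1 : ∀ᵐ y : ℝ, y ≠ 1 := by simp [ae_iff]
      filter_upwards [h1] with y hy1 hy
      have e1 : 0 ≤ y ^ (a - 1) := Real.rpow_nonneg hy.1.le _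
      have e2 : 0 ≤ |y - 1| ^ (-u) := Real.rpow_nonneg (abs_nonneg _) _
      refine (norm_indicator_le_norm_self _ _).trans ?_
      rw [norm_mul, Complex.norm_real, Real.norm_of_nonneg e1, norm_upperPow]
      refine mul_le_mul_of_nonneg_left ?_ e1
      refine Real.rpow_le_rpow_of_nonpos (abs_pos.mpr (sub_ne_zero.mpr hy1)) ?_ (by linarith)
      have h3 := abs_norm_sub_norm_le ((y : ℂ) * Complex.exp (φ * Complex.I)) 1
      rwa [norm_mul, Complex.norm_exp_ofReal_mul_I, Complex.norm_real,
        Real.norm_of_nonneg hy.1.le, mul_one, norm_one] at h3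
    · have := intervalIntegrable_rpow_mul_abs_sub_one_rpow ha hu0 hu1
        (show 0 ≤ R₀ + 1 by linarith)
      rwa [intervalIntegrable_iff_integrableOn_Ioc_of_le (by linarith)] at this
    · refine (ae_restrict_iff' measurableSet_Ioc).mpr ?_
      have h1 : ∀ᵐ y : ℝ, y ≠ 1 := by simp [ae_iff]
      have h2 : ∀ᵐ y : ℝ, y ≠ R₀ := by simp [ae_iff]
      filter_upwards [h1, h2] with y hy1 hy2 hy
      rcases lt_or_gt_of_ne hy2 with h | h
      · have hmem : y ∈ Ioc 0 R₀ := ⟨hy.1, h.le⟩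
        simp only [hf₀, indicator_of_mem hmem]
        have hc : ContinuousAt (fun φ : ℝ => ((y ^ (a - 1) : ℝ) : ℂ) *
            upperPow u ((y : ℂ) * Complex.exp (φ * Complex.I) - 1)) φ₀ := by
          refine continuousAt_const.mul (ContinuousAt.comp
            (f := fun φ : ℝ => (y : ℂ) * Complex.exp (φ * Complex.I) - 1)
            (continuousAt_upperPow u ?_) (by fun_prop))
          rcases hφ₀.eq_or_lt with h0 | h0
          · right
            rw [← h0]
            simpa [sub_eq_zero] using hy1
          · left
            have : 0 < y * Real.sin φ₀ :=
              mul_pos hy.1 (Real.sin_pos_of_pos_of_lt_pi h0 hφ₁)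
            simpa [Complex.exp_ofReal_mul_I_im] using this
        refine (hc.tendsto.comp hφ).congr' ?_
        filter_upwards [hR.eventually (eventually_gt_nhds h)] with φ hφ'
        have : y ∈ Ioc 0 (R φ) := ⟨hy.1, hφ'.le⟩
        simp only [hF, indicator_of_mem this, Function.comp, id]
      · have hmem : y ∉ Ioc 0 R₀ := fun h' => absurd h'.2 (not_le.mpr h)
        simp only [hf₀, indicator_of_notMem hmem]
        refine tendsto_const_nhds.congr' ?_
        filter_upwards [hR.eventually (eventually_lt_nhds h)] with φ hφ'
        have : y ∉ Ioc 0 (R φ) := fun h' => absurd h'.2 (not_le.mpr hφ')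
        simp only [hF, indicator_of_notMem this]
  rw [hf₀int]
  have hexp : Tendsto (fun φ : ℝ => Complex.exp ((a * φ : ℝ) * Complex.I)) l
      (𝓝 (Complex.exp ((a * φ₀ : ℝ) * Complex.I))) := by
    have : Continuous fun φ : ℝ => Complex.exp ((a * φ : ℝ) * Complex.I) := by fun_prop
    exact (this.tendsto φ₀).comp hφ
  refine (hexp.mul hlim).congr' ?_
  filter_upwards [hφl, hRpos, hR.eventually (eventually_lt_nhds (show R₀ < R₀ + 1 by linarith))]
    with φ h1 h2 h3
  rw [raneyPrimitive_polar u h2 (by linarith [h1.1, Real.pi_pos]) h1.2.le, hFint φ h2.le h3.le]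

/-- On the real axis only the part of the path to the left of `1` contributes to the imaginary
part, and its contribution is a Beta integral. -/
theorem im_integral_rpow_mul_upperPow {a u b : ℝ} (ha : 0 < a) (hu0 : 0 ≤ u) (hu1 : u < 1)
    (hb : 1 ≤ b) :
    ((∫ y in (0 : ℝ)..b, ((y ^ (a - 1) : ℝ) : ℂ) * upperPow u ((y : ℂ) - 1)).im : ℂ) =
      -(Real.sin (Real.pi * u) : ℂ) * Complex.betaIntegral a (1 - u) := by
  have hmeas : Measurable fun y : ℝ => ((y ^ (a - 1) : ℝ) : ℂ) * upperPow u ((y : ℂ) - 1) :=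
    Measurable.mul (by fun_prop)
      ((measurable_upperPow u).comp (show Measurable fun y : ℝ => (y : ℂ) - 1 by fun_prop))
  have hint : ∀ {c d : ℝ}, 0 ≤ c → c ≤ d → d ≤ b → IntervalIntegrable
      (fun y : ℝ => ((y ^ (a - 1) : ℝ) : ℂ) * upperPow u ((y : ℂ) - 1)) volume c d := by
    intro c d hc hcd hd
    have h1 := (intervalIntegrable_rpow_mul_abs_sub_one_rpow ha hu0 hu1
      (show 0 ≤ b by linarith)).mono_set (show uIcc c d ⊆ uIcc 0 b by
        rw [uIcc_of_le hcd, uIcc_of_le (by linarith)]; exact Icc_subset_Icc hc hd)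
    refine h1.mono_fun' hmeas.aestronglyMeasurable ?_
    refine (ae_restrict_iff' measurableSet_uIoc).mpr (Eventually.of_forall fun y hy => ?_)
    rw [uIoc_of_le hcd] at hy
    have hy0 : 0 ≤ y := by linarith [hy.1]
    simp only
    rw [norm_mul, Complex.norm_real, Real.norm_of_nonneg (Real.rpow_nonneg hy0 _), norm_upperPow,
      ← Complex.ofReal_one, ← Complex.ofReal_sub, Complex.norm_real, Real.norm_eq_abs]
  have hleft : ∫ y in (0 : ℝ)..1, ((y ^ (a - 1) : ℝ) : ℂ) * upperPow u ((y : ℂ) - 1) =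
      Complex.exp ((-u * Real.pi : ℝ) * Complex.I) *
        ((∫ y in (0 : ℝ)..1, y ^ (a - 1) * (1 - y) ^ (-u) : ℝ) : ℂ) := by
    rw [← intervalIntegral.integral_ofReal, ← intervalIntegral.integral_const_mul]
    refine intervalIntegral.integral_congr_ae ?_
    have h1 : ∀ᵐ y : ℝ, y ≠ 1 := by simp [ae_iff]
    filter_upwards [h1] with y hy1 hy
    rw [uIoc_of_le zero_le_one] at hy
    have hy' : 0 < 1 - y := sub_pos.mpr (lt_of_le_of_ne hy.2 hy1)
    have h2 : (y : ℂ) - 1 = ((1 - y : ℝ) : ℂ) * Complex.exp (Real.pi * Complex.I) := by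
      rw [Complex.exp_pi_mul_I]; push_cast; ring
    rw [h2, upperPow_ofReal_mul_exp hy' Real.pi_pos.le le_rfl]
    push_cast
    ring
  have hright : ∫ y in (1 : ℝ)..b, ((y ^ (a - 1) : ℝ) : ℂ) * upperPow u ((y : ℂ) - 1) =
      ((∫ y in (1 : ℝ)..b, y ^ (a - 1) * (y - 1) ^ (-u) : ℝ) : ℂ) := by
    rw [← intervalIntegral.integral_ofReal]
    refine intervalIntegral.integral_congr_ae (Eventually.of_forall fun y hy => ?_)
    rw [uIoc_of_le hb] at hy
    have h2 : (y : ℂ) - 1 = ((y - 1 : ℝ) : ℂ) * Complex.exp ((0 : ℝ) * Complex.I) := by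
      simp
    rw [h2, upperPow_ofReal_mul_exp (by linarith [hy.1]) le_rfl Real.pi_pos.le]
    simp
  have hbeta : Complex.betaIntegral a (1 - u) =
      ((∫ y in (0 : ℝ)..1, y ^ (a - 1) * (1 - y) ^ (-u) : ℝ) : ℂ) := by
    rw [Complex.betaIntegral, ← intervalIntegral.integral_ofReal]
    refine intervalIntegral.integral_congr fun y hy => ?_
    rw [uIcc_of_le zero_le_one] at hy
    rw [Complex.ofReal_mul, Complex.ofReal_cpow hy.1, Complex.ofReal_cpow (by linarith [hy.2])]
    push_cast
    congr 2
    ring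
  rw [← intervalIntegral.integral_add_adjacent_intervals (hint le_rfl zero_le_one hb)
    (hint zero_le_one hb le_rfl), hleft, hright, hbeta, Complex.add_im, Complex.ofReal_im, add_zero,
    Complex.im_mul_ofReal, Complex.exp_ofReal_mul_I_im]
  rw [show -u * Real.pi = -(Real.pi * u) by ring, Real.sin_neg]
  push_cast
  ring

/-! ### The Mellin transform of `x W(x)` -/

theorem locallyIntegrableOn_isBigO_raneyProfile {p r : ℝ} (hp : 1 < p) (hr : 0 < r) (hrp : r ≤ p) :
    LocallyIntegrableOn (fun x => (raneyProfile p r x : ℂ)) (Ioi 0) ∧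
      (∀ a : ℝ, (fun x => (raneyProfile p r x : ℂ)) =O[atTop] (· ^ (-a))) ∧
      (fun x => (raneyProfile p r x : ℂ)) =O[𝓝[>] 0] (· ^ (-(-(r / p)))) := by
  obtain ⟨C, hC0, hC⟩ := exists_raneyProfile_le hp hr
  have hnn := raneyProfile_nonneg hp hr hrp
  have hnorm : ∀ x, 0 < x → ‖(raneyProfile p r x : ℂ)‖ ≤ C * x ^ (r / p) := fun x hx => by
    rw [Complex.norm_real, Real.norm_of_nonneg (hnn x)]
    exact hC x hx
  refine ⟨?_, fun a => ?_, ?_⟩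
  · have h1 : LocallyIntegrableOn (fun x : ℝ => C * x ^ (r / p)) (Ioi 0) := by
      refine ContinuousOn.locallyIntegrableOn ?_ measurableSet_Ioi
      refine continuousOn_const.mul (continuousOn_id.rpow_const fun x hx => Or.inl ?_)
      exact ne_of_gt hx
    intro x hx
    obtain ⟨s, hs, hi⟩ := h1 x hx
    refine ⟨s ∩ Ioi 0, inter_mem hs self_mem_nhdsWithin, ?_⟩
    refine Integrable.mono' (hi.mono_set inter_subset_left)
      (Complex.measurable_ofReal.comp (measurable_raneyProfile hp r)).aestronglyMeasurable ?_
    have h2 : MeasurableSet (Ioi (0 : ℝ)) := measurableSet_Ioi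
    have h3 : ∀ᵐ y ∂(volume.restrict (Ioi (0 : ℝ))), ‖(raneyProfile p r y : ℂ)‖ ≤
        C * y ^ (r / p) :=
      (ae_restrict_iff' h2).mpr (Eventually.of_forall hnorm)
    exact ae_mono (Measure.restrict_mono inter_subset_right le_rfl) h3
  · refine Asymptotics.IsBigO.of_bound 0 ?_
    filter_upwards [eventually_ge_atTop (raneyEndpoint p)] with x hx
    rw [raneyProfile_of_notMem fun h => absurd h.2 (not_lt.mpr hx)]
    simp
  · refine Asymptotics.IsBigO.of_bound C ?_
    filter_upwards [self_mem_nhdsWithin] with x hx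
    rw [neg_neg, Real.norm_of_nonneg (Real.rpow_nonneg (le_of_lt hx) _)]
    exact hnorm x hx

theorem mellinConvergent_raneyProfile {p r : ℝ} (hp : 1 < p) (hr : 0 < r) (hrp : r ≤ p) {s : ℂ}
    (hs : -(r / p) < s.re) : MellinConvergent (fun x => (raneyProfile p r x : ℂ)) s := by
  obtain ⟨h1, h2, h3⟩ := locallyIntegrableOn_isBigO_raneyProfile hp hr hrp
  exact mellinConvergent_of_isBigO_rpow h1 (h2 (s.re + 1)) (by linarith) h3 hs

theorem differentiableAt_mellin_raneyProfile {p r : ℝ} (hp : 1 < p) (hr : 0 < r) (hrp : r ≤ p)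
    {s : ℂ} (hs : -(r / p) < s.re) :
    DifferentiableAt ℂ (mellin fun x => (raneyProfile p r x : ℂ)) s := by
  obtain ⟨h1, h2, h3⟩ := locallyIntegrableOn_isBigO_raneyProfile hp hr hrp
  exact mellin_differentiableAt_of_isBigO_rpow h1 (h2 (s.re + 1)) (by linarith) h3 hs

/-- The function of the angle whose derivative is the integrand of the Mellin transform in the
variable `φ`: integration by parts against `x ^ u` produces the primitive along the curve. -/
def raneyAntideriv (p r u φ : ℝ) : ℝ :=
  raneyAbscissa p φ ^ u * (raneyRadius p φ ^ r * Real.sin (r * φ)) / u -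
    r / u * (raneyPrimitive (p * u + r) u (raneyPoint p φ)).im

theorem hasDerivAt_raneyAntideriv {p r u φ : ℝ} (hp : 1 < p) (hr : 0 < r) (hu : 0 < u)
    (hφ : φ ∈ Ioo 0 (Real.pi / p)) :
    HasDerivAt (raneyAntideriv p r u) (raneyAbscissa p φ ^ u * raneyLogDeriv p φ *
      (raneyRadius p φ ^ r * Real.sin (r * φ))) φ := by
  obtain ⟨h0, h1, h2, h3, h4⟩ := raney_angle_bounds hp hφ
  have hR := raneyRadius_pos hp hφ
  have hS := raneyShift_pos hp hφ
  have hρ := raneyAbscissa_pos hp hφ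
  set D : ℝ := p * (Real.cos (p * φ) / Real.sin (p * φ)) -
      (p - 1) * (Real.cos ((p - 1) * φ) / Real.sin ((p - 1) * φ)) with hD
  have hRd : HasDerivAt (raneyRadius p) (raneyRadius p φ * D) φ := hasDerivAt_raneyRadius hp hφ
  -- the real part of the antiderivative
  have d1 : HasDerivAt (fun φ => raneyAbscissa p φ ^ u)
      (u * raneyAbscissa p φ ^ u * raneyLogDeriv p φ) φ := by
    refine ((hasDerivAt_raneyAbscissa hp hφ).rpow_const (p := u) (Or.inl hρ.ne')).congr_deriv ?_
    rw [Real.rpow_sub_one hρ.ne']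
    field_simp
  have d2 : HasDerivAt (fun φ => raneyRadius p φ ^ r * Real.sin (r * φ))
      (r * raneyRadius p φ ^ r * (D * Real.sin (r * φ) + Real.cos (r * φ))) φ := by
    have e1 := hRd.rpow_const (p := r) (Or.inl hR.ne')
    have e2 : HasDerivAt (fun φ => Real.sin (r * φ)) (Real.cos (r * φ) * r) φ := by
      simpa using ((hasDerivAt_id φ).const_mul r).sin
    refine (e1.mul e2).congr_deriv ?_
    rw [Real.rpow_sub_one hR.ne']
    field_simp
  -- the derivative of the primitive along the curve
  have d3 : HasDerivAt (raneyPoint p)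
      ((raneyRadius p φ : ℂ) * Complex.exp (φ * Complex.I) * (D + Complex.I)) φ := by
    have e1 : HasDerivAt (fun φ : ℝ => Complex.exp (φ * Complex.I))
        (Complex.exp (φ * Complex.I) * Complex.I) φ := by
      have : HasDerivAt (fun φ : ℝ => (φ : ℂ) * Complex.I) Complex.I φ := by
        simpa using (Complex.ofRealCLM.hasDerivAt (x := φ)).mul_const Complex.I
      exact this.cexp
    refine (hRd.ofReal_comp.mul e1).congr_deriv ?_
    push_cast
    ring
  have him : 0 < (raneyPoint p φ).im := by
    rw [raneyPoint, Complex.im_ofReal_mul, Complex.exp_ofReal_mul_I_im]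
    exact mul_pos hR (Real.sin_pos_of_pos_of_lt_pi h0 h2)
  have hprim := (hasDerivAt_raneyPrimitive (a := p * u + r) (u := u) (by positivity) hu.le
    him).comp φ d3
  have hval : raneyPoint p φ ^ (((p * u + r : ℝ) : ℂ) - 1) * upperPow u (raneyPoint p φ - 1) *
      ((raneyRadius p φ : ℂ) * Complex.exp (φ * Complex.I) * (D + Complex.I)) =
      ((raneyAbscissa p φ ^ u * raneyRadius p φ ^ r : ℝ) : ℂ) *
        (Complex.exp ((r * φ : ℝ) * Complex.I) * (D + Complex.I)) := by
    have e1 : raneyAbscissa p φ ^ u * raneyRadius p φ ^ r =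
        raneyRadius p φ ^ (p * u + r - 1) * raneyShift p φ ^ (-u) * raneyRadius p φ := by
      rw [raneyAbscissa, Real.div_rpow (by positivity) hS.le, ← Real.rpow_mul hR.le,
        Real.rpow_sub_one hR.ne', Real.rpow_add hR, Real.rpow_neg hS.le]
      field_simp
    have e2 : Complex.exp ((r * φ : ℝ) * Complex.I) =
        Complex.exp (((p * u + r - 1) * φ : ℝ) * Complex.I) *
        Complex.exp ((-u * (p * φ) : ℝ) * Complex.I) * Complex.exp (φ * Complex.I) := by
      rw [← Complex.exp_add, ← Complex.exp_add]
      congr 1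
      push_cast
      ring
    rw [raneyPoint_sub_one hp hφ, upperPow_ofReal_mul_exp hS (by positivity) h1.le, raneyPoint,
      ← Complex.ofReal_one, ← Complex.ofReal_sub, ofReal_mul_exp_cpow hR (by linarith) h2.le,
      e1, e2]
    push_cast
    ring
  have d4 : HasDerivAt (fun φ => (raneyPrimitive (p * u + r) u (raneyPoint p φ)).im)
      (raneyAbscissa p φ ^ u * raneyRadius p φ ^ r *
        (D * Real.sin (r * φ) + Real.cos (r * φ))) φ := by
    have e1 := (Complex.imCLM.hasFDerivAt.comp_hasDerivAt φ hprim)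
    refine e1.congr_deriv ?_
    rw [hval, Complex.imCLM_apply, Complex.im_ofReal_mul, Complex.mul_im,
      Complex.exp_ofReal_mul_I_im, Complex.exp_ofReal_mul_I_re]
    simp only [Complex.add_re, Complex.add_im, Complex.ofReal_re, Complex.ofReal_im, Complex.I_re,
      Complex.I_im]
    ring
  refine (((d1.mul d2).div_const u).sub (d4.const_mul (r / u))).congr_deriv ?_
  field_simp
  ring

theorem tendsto_raneyAntideriv_zero {p r u : ℝ} (hp : 1 < p) (hr : 0 < r) (hu : 0 < u)
    (hu1 : u < 1) :
    Tendsto (fun φ => (raneyAntideriv p r u φ : ℂ)) (𝓝[>] 0)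
      (𝓝 (r / u * Real.sin (Real.pi * u) * Complex.betaIntegral (p * u + r) (1 - u))) := by
  have hp0 : 0 < p := by linarith
  have hq : 0 < p - 1 := by linarith
  have hpos : 0 < Real.pi / p := div_pos Real.pi_pos hp0
  have hI : ∀ᶠ φ in 𝓝[>] (0 : ℝ), φ ∈ Ioo 0 (Real.pi / p) := Ioo_mem_nhdsGT hpos
  have hsin : Tendsto (fun φ => Real.sin (r * φ)) (𝓝[>] 0) (𝓝 0) := by
    have : Continuous fun φ => Real.sin (r * φ) := by fun_prop
    have h := this.tendsto 0
    rw [mul_zero, Real.sin_zero] at h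
    exact h.mono_left nhdsWithin_le_nhds
  have h1 := (((tendsto_raneyAbscissa_zero hp).rpow_const (p := u) (Or.inr hu.le)).mul
    (((tendsto_raneyRadius_zero hp).rpow_const (p := r) (Or.inr hr.le)).mul hsin)).div_const u
  have h2 := tendsto_raneyPrimitive (a := p * u + r) (u := u) (by positivity) hu.le hu1
    (l := 𝓝[>] 0) (R := raneyRadius p) (φ₀ := 0) (tendsto_id.mono_left nhdsWithin_le_nhds) le_rfl
    Real.pi_pos (hI.mono fun φ hφ => ⟨hφ.1, hφ.2.trans (div_lt_self Real.pi_pos hp)⟩)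
    (tendsto_raneyRadius_zero hp) (hI.mono fun φ hφ => raneyRadius_pos hp hφ) (by positivity)
  have h3 := (Complex.continuous_im.tendsto _).comp h2
  have h4 := (Complex.continuous_ofReal.tendsto _).comp (h1.sub (h3.const_mul (r / u)))
  refine (h4.congr fun φ => ?_).trans_eq ?_
  · rfl
  · congr 1
    have h5 := im_integral_rpow_mul_upperPow (a := p * u + r) (u := u) (b := p / (p - 1))
      (by positivity) hu.le hu1 (by rw [le_div_iff₀ hq]; linarith)
    simp only [mul_zero, Complex.ofReal_zero, zero_mul, Complex.exp_zero, mul_one, one_mul,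
      zero_div, zero_sub]
    rw [Complex.ofReal_neg, Complex.ofReal_mul, h5]
    push_cast
    ring

theorem tendsto_raneyAntideriv_pi_div {p r u : ℝ} (hp : 1 < p) (hr : 0 < r) (hu : 0 < u)
    (hu1 : u < 1) :
    Tendsto (fun φ => (raneyAntideriv p r u φ : ℂ)) (𝓝[<] (Real.pi / p)) (𝓝 0) := by
  have hp0 : 0 < p := by linarith
  have hpos : 0 < Real.pi / p := div_pos Real.pi_pos hp0
  have hI : ∀ᶠ φ in 𝓝[<] (Real.pi / p), φ ∈ Ioo 0 (Real.pi / p) := Ioo_mem_nhdsLT hpos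
  have hsin : Tendsto (fun φ => Real.sin (r * φ)) (𝓝[<] (Real.pi / p))
      (𝓝 (Real.sin (r * (Real.pi / p)))) := by
    have : Continuous fun φ => Real.sin (r * φ) := by fun_prop
    exact (this.tendsto _).mono_left nhdsWithin_le_nhds
  have h1 := (((tendsto_raneyAbscissa_pi_div hp).rpow_const (p := u) (Or.inr hu.le)).mul
    (((tendsto_raneyRadius_pi_div hp).rpow_const (p := r) (Or.inr hr.le)).mul hsin)).div_const u
  have h2 := tendsto_raneyPrimitive (a := p * u + r) (u := u) (by positivity) hu.le hu1
    (l := 𝓝[<] (Real.pi / p)) (R := raneyRadius p) (φ₀ := Real.pi / p)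
    (tendsto_id.mono_left nhdsWithin_le_nhds) hpos.le (div_lt_self Real.pi_pos hp)
    (hI.mono fun φ hφ => ⟨hφ.1, hφ.2.trans (div_lt_self Real.pi_pos hp)⟩)
    (tendsto_raneyRadius_pi_div hp) (hI.mono fun φ hφ => raneyRadius_pos hp hφ) le_rfl
  have h3 := (Complex.continuous_im.tendsto _).comp h2
  have h4 := (Complex.continuous_ofReal.tendsto _).comp (h1.sub (h3.const_mul (r / u)))
  refine (h4.congr fun φ => ?_).trans_eq ?_
  · rfl
  · congr 1
    simp [Real.zero_rpow hu.ne']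

theorem mellin_raneyProfile_of_mem_Ioo {p r u : ℝ} (hp : 1 < p) (hr : 0 < r) (hrp : r ≤ p)
    (hu : 0 < u) (hu1 : u < 1) :
    mellin (fun x => (raneyProfile p r x : ℂ)) u =
      r * Complex.Gamma (p * u + r) /
        (Complex.Gamma (u + 1) * Complex.Gamma ((p - 1) * u + r + 1)) := by
  have hp0 : 0 < p := by linarith
  have hpos : 0 < Real.pi / p := div_pos Real.pi_pos hp0
  have hrp0 : 0 < r / p := by positivity
  set g : ℝ → ℂ := fun x => (x : ℂ) ^ ((u : ℂ) - 1) • (raneyProfile p r x : ℂ) with hg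
  have hgint : IntegrableOn g (Ioo 0 (raneyEndpoint p)) :=
    (mellinConvergent_raneyProfile hp hr hrp (s := u) (by simp; linarith)).mono_set
      Ioo_subset_Ioi_self
  have hder : ∀ φ ∈ Ioo 0 (Real.pi / p), HasDerivWithinAt (raneyAbscissa p)
      (raneyAbscissa p φ * raneyLogDeriv p φ) (Ioo 0 (Real.pi / p)) φ := fun φ hφ =>
    (hasDerivAt_raneyAbscissa hp hφ).hasDerivWithinAt
  have hinj := (strictAntiOn_raneyAbscissa hp).injOn
  -- the integrand in the variable `φ`
  have hsub : ∀ φ ∈ Ioo 0 (Real.pi / p),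
      |raneyAbscissa p φ * raneyLogDeriv p φ| • g (raneyAbscissa p φ) =
      -(1 / Real.pi : ℂ) * ((raneyAbscissa p φ ^ u * raneyLogDeriv p φ *
        (raneyRadius p φ ^ r * Real.sin (r * φ)) : ℝ) : ℂ) := by
    intro φ hφ
    have hρ := raneyAbscissa_pos hp hφ
    have hL := raneyLogDeriv_neg hp hφ
    have e1 : raneyAbscissa p φ ^ u = raneyAbscissa p φ ^ (u - 1) * raneyAbscissa p φ := by
      rw [← Real.rpow_add_one hρ.ne', sub_add_cancel]
    simp only [hg]
    rw [abs_of_neg (mul_neg_of_pos_of_neg hρ hL), raneyProfile_raneyAbscissa hp hφ,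
      ← Complex.ofReal_one, ← Complex.ofReal_sub, ← Complex.ofReal_cpow hρ.le, e1]
    simp only [Complex.real_smul, smul_eq_mul]
    push_cast
    ring
  have hcov : mellin (fun x => (raneyProfile p r x : ℂ)) u =
      ∫ φ in Ioo 0 (Real.pi / p), -(1 / Real.pi : ℂ) * ((raneyAbscissa p φ ^ u *
        raneyLogDeriv p φ * (raneyRadius p φ ^ r * Real.sin (r * φ)) : ℝ) : ℂ) := by
    rw [mellin, ← setIntegral_congr_fun measurableSet_Ioo hsub,
      ← integral_image_eq_integral_abs_deriv_smul measurableSet_Ioo hder hinj,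
      image_raneyAbscissa hp]
    refine setIntegral_eq_of_subset_of_forall_sdiff_eq_zero measurableSet_Ioi Ioo_subset_Ioi_self
      fun x hx => ?_
    rw [raneyProfile_of_notMem hx.2]
    simp
  have hint : IntervalIntegrable (fun φ => ((raneyAbscissa p φ ^ u * raneyLogDeriv p φ *
      (raneyRadius p φ ^ r * Real.sin (r * φ)) : ℝ) : ℂ)) volume 0 (Real.pi / p) := by
    rw [intervalIntegrable_iff_integrableOn_Ioo_of_le hpos.le]
    rw [← image_raneyAbscissa hp, integrableOn_image_iff_integrableOn_abs_deriv_smul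
      measurableSet_Ioo hder hinj, integrableOn_congr_fun hsub measurableSet_Ioo] at hgint
    have := hgint.const_mul (-(Real.pi : ℂ))
    refine this.congr (Eventually.of_forall fun φ => ?_)
    have hpi : (Real.pi : ℂ) ≠ 0 := by exact_mod_cast Real.pi_ne_zero
    simp only
    field_simp
  have hFTC := intervalIntegral.integral_eq_sub_of_hasDerivAt_of_tendsto hpos
    (fun φ hφ => (hasDerivAt_raneyAntideriv hp hr hu hφ).ofReal_comp) hint
    (tendsto_raneyAntideriv_zero hp hr hu hu1) (tendsto_raneyAntideriv_pi_div hp hr hu hu1)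
  rw [intervalIntegral.integral_of_le hpos.le, integral_Ioc_eq_integral_Ioo] at hFTC
  rw [hcov, integral_const_mul, hFTC]
  -- the reflection formula turns the Beta integral into the quotient of Gamma functions
  have hpi : (Real.pi : ℂ) ≠ 0 := by exact_mod_cast Real.pi_ne_zero
  have huC : (u : ℂ) ≠ 0 := by exact_mod_cast hu.ne'
  have hB := Complex.Gamma_mul_Gamma_eq_betaIntegral (s := p * u + r) (t := 1 - u)
    (by simp; positivity) (by simpa using hu1)
  rw [show (p * u + r + (1 - u) : ℂ) = (p - 1) * u + r + 1 by ring] at hB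
  have hΓ0 : Complex.Gamma ((p - 1) * u + r + 1) ≠ 0 :=
    Complex.Gamma_ne_zero_of_re_pos (by
      simp
      have : 0 < (p - 1) * u := mul_pos (by linarith) hu
      linarith)
  have hΓu : Complex.Gamma u ≠ 0 := Complex.Gamma_ne_zero_of_re_pos (by simpa using hu)
  have hrefl := Complex.Gamma_mul_Gamma_one_sub (u : ℂ)
  have hsin : Complex.sin (Real.pi * u) ≠ 0 := by
    have : 0 < Real.sin (Real.pi * u) := Real.sin_pos_of_pos_of_lt_pi
      (mul_pos Real.pi_pos hu) (by nlinarith [Real.pi_pos])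
    rw [← Complex.ofReal_mul, ← Complex.ofReal_sin]
    exact_mod_cast this.ne'
  rw [eq_div_iff hsin] at hrefl
  rw [Complex.Gamma_add_one _ huC, eq_div_iff (by positivity), Complex.ofReal_sin,
    Complex.ofReal_mul]
  generalize Complex.sin (Real.pi * u) = s at *
  generalize Complex.Gamma (p * u + r) = A at *
  generalize Complex.betaIntegral (p * u + r) (1 - u) = B at *
  generalize Complex.Gamma ((p - 1) * u + r + 1) = E at *
  generalize Complex.Gamma (1 - u) = F at *
  generalize Complex.Gamma (u : ℂ) = H at *
  field_simp
  linear_combination (-(r * s * H)) * hB + r * A * hrefl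

/-- The meromorphic function whose values at the natural numbers are the Raney numbers. -/
def raneyMellin (p r : ℝ) (s : ℂ) : ℂ :=
  r * Complex.Gamma (p * s + r) / (Complex.Gamma (s + 1) * Complex.Gamma ((p - 1) * s + r + 1))

theorem differentiableAt_raneyMellin {p r : ℝ} (hp : 1 < p) {s : ℂ} (hs : -(r / p) < s.re) :
    DifferentiableAt ℂ (raneyMellin p r) s := by
  have hp0 : 0 < p := by linarith
  have hre : 0 < (p * s + r : ℂ).re := by
    have := (lt_div_iff₀ hp0).mp (show -s.re < r / p by linarith)
    simp
    linarith
  have h1 : DifferentiableAt ℂ (fun s : ℂ => Complex.Gamma (p * s + r)) s := by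
    refine DifferentiableAt.comp (f := fun s : ℂ => (p * s + r : ℂ)) s
      (Complex.differentiableAt_Gamma _ fun m h => ?_) (by fun_prop)
    rw [h] at hre
    simp at hre
    have : (0 : ℝ) ≤ m := m.cast_nonneg
    linarith
  have h2 : DifferentiableAt ℂ (fun s : ℂ => (Complex.Gamma (s + 1))⁻¹) s :=
    DifferentiableAt.comp (f := fun s : ℂ => s + 1) s
      (Complex.differentiable_one_div_Gamma _) (by fun_prop)
  have h3 : DifferentiableAt ℂ (fun s : ℂ => (Complex.Gamma ((p - 1) * s + r + 1))⁻¹) s :=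
    DifferentiableAt.comp (f := fun s : ℂ => ((p - 1) * s + r + 1 : ℂ)) s
      (Complex.differentiable_one_div_Gamma _) (by fun_prop)
  have h4 := (h1.const_mul (r : ℂ)).mul (h2.mul h3)
  refine h4.congr_of_eventuallyEq (Eventually.of_forall fun z => ?_)
  simp only [raneyMellin, Pi.mul_apply]
  rw [div_eq_mul_inv, mul_inv]

/-- The formula for the Mellin transform extends from `(0, 1)` to the whole half-plane of
convergence by the identity theorem. -/
theorem mellin_raneyProfile {p r : ℝ} (hp : 1 < p) (hr : 0 < r) (hrp : r ≤ p) {s : ℂ}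
    (hs : -(r / p) < s.re) :
    mellin (fun x => (raneyProfile p r x : ℂ)) s = raneyMellin p r s := by
  have hp0 : 0 < p := by linarith
  have hrp0 : 0 < r / p := by positivity
  set U : Set ℂ := {s | -(r / p) < s.re} with hU
  have hUo : IsOpen U := isOpen_lt continuous_const Complex.continuous_re
  have hUc : IsPreconnected U := (convex_halfSpace_re_gt _).isPreconnected
  have hf : AnalyticOnNhd ℂ (mellin fun x => (raneyProfile p r x : ℂ)) U :=
    DifferentiableOn.analyticOnNhd (fun s hs =>
      (differentiableAt_mellin_raneyProfile hp hr hrp hs).differentiableWithinAt) hUo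
  have hg : AnalyticOnNhd ℂ (raneyMellin p r) U :=
    DifferentiableOn.analyticOnNhd (fun s hs =>
      (differentiableAt_raneyMellin hp hs).differentiableWithinAt) hUo
  have hz : ((1 / 2 : ℝ) : ℂ) ∈ U := by
    simp only [hU, mem_ofPred_eq, Complex.ofReal_re]
    linarith
  have ht : Tendsto (fun t : ℝ => (t : ℂ)) (𝓝[≠] (1 / 2)) (𝓝[≠] ((1 / 2 : ℝ) : ℂ)) := by
    refine tendsto_nhdsWithin_iff.mpr ⟨?_, ?_⟩
    · exact (Complex.continuous_ofReal.tendsto _).mono_left nhdsWithin_le_nhds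
    · filter_upwards [self_mem_nhdsWithin] with t ht
      simpa only [mem_compl_iff, mem_singleton_iff, Complex.ofReal_inj] using ht
  have hev : ∀ᶠ t : ℝ in 𝓝[≠] (1 / 2),
      mellin (fun x => (raneyProfile p r x : ℂ)) (t : ℂ) = raneyMellin p r t := by
    filter_upwards [mem_nhdsWithin_of_mem_nhds
      (Ioo_mem_nhds (show (0 : ℝ) < 1 / 2 by norm_num) (show (1 / 2 : ℝ) < 1 by norm_num))] with t ht
    exact mellin_raneyProfile_of_mem_Ioo hp hr hrp ht.1 ht.2
  exact hf.eqOn_of_preconnected_of_frequently_eq hg hUc hz (ht.frequently hev.frequently) hs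

theorem raneyMellin_natCast {p r : ℝ} (hp : 1 < p) (hr : 0 < r) (m : ℕ) :
    raneyMellin p r m = (raneyNumber p r m : ℂ) := by
  have hr' : (r : ℂ) ≠ 0 := by exact_mod_cast hr.ne'
  rcases Nat.eq_zero_or_pos m with rfl | hm
  · have hΓ : Complex.Gamma r ≠ 0 := Complex.Gamma_ne_zero_of_re_pos (by simpa using hr)
    simp [raneyMellin, raneyNumber, Complex.Gamma_add_one _ hr', hr', hΓ]
  obtain ⟨n, rfl⟩ : ∃ n, m = n + 1 := ⟨m - 1, by omega⟩
  set z : ℂ := (p - 1) * ((n + 1 : ℕ) : ℂ) + r + 1 with hz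
  have hre : 0 < z.re := by
    have : (0 : ℝ) < (p - 1) * (n + 1) := mul_pos (by linarith) (by positivity)
    simp [hz]
    linarith
  have hzne : ∀ k : ℕ, z ≠ -k := fun k h => by
    rw [h] at hre
    simp at hre
    have : (0 : ℝ) ≤ k := k.cast_nonneg
    linarith
  have h1 := Complex.Gamma_add_nat_div_Gamma_eq (n := n) z hzne
  have hΓ : Complex.Gamma z ≠ 0 := Complex.Gamma_ne_zero_of_re_pos hre
  have h2 : (p * ((n + 1 : ℕ) : ℂ) + r : ℂ) = z + n := by
    rw [hz]; push_cast; ring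
  have h3 : (raneyNumber p r (n + 1) : ℂ) =
      r / ((n + 1).factorial : ℂ) * ∏ i ∈ Finset.range n, (z + i) := by
    rw [raneyNumber, if_neg n.succ_ne_zero, Finset.prod_Ico_eq_prod_range, Nat.add_sub_cancel,
      ← Finset.prod_range_reflect]
    push_cast
    congr 1
    refine Finset.prod_congr rfl fun i hi => ?_
    have hi' : i + 1 ≤ n := Finset.mem_range.mp hi
    rw [Nat.sub_sub, Nat.cast_sub (by omega), hz]
    push_cast
    ring
  have h4 : ∀ n : ℕ, (ascPochhammer ℂ n).eval z = ∏ i ∈ Finset.range n, (z + i) := by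
    intro n
    induction n with
    | zero => simp
    | succ n ih => rw [ascPochhammer_succ_eval, ih, Finset.prod_range_succ]
  rw [raneyMellin, h2, Complex.Gamma_nat_eq_factorial, h3, ← h4, ← h1, ← hz]
  field_simp

/-! ### The Mellin–Barnes integral -/

theorem ofReal_rpow_eq_exp {x : ℝ} (hx : 0 < x) (y : ℝ) :
    ((x ^ y : ℝ) : ℂ) = Complex.exp (Real.log x * y) := by
  rw [Real.rpow_def_of_pos hx]
  push_cast
  rfl

theorem ofReal_cpow_eq_exp {x : ℝ} (hx : 0 < x) (w : ℂ) :
    (x : ℂ) ^ w = Complex.exp (Real.log x * w) := by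
  rw [Complex.cpow_def_of_ne_zero (by exact_mod_cast hx.ne'), ← Complex.ofReal_log hx.le]

/-- The quotient of the Meijer function at `x ^ l / c(p) ^ l` by `x W(x)`. -/
def meijerFactor (k : ℕ) (p r : ℝ) : ℝ :=
  √(2 * k * Real.pi) * p ^ (-r) * (p - 1) ^ (r + 1 / 2) / r

theorem meijerGKernel_eq_prod_div_prod {k : ℕ} (a b : Fin k → ℂ) (s : ℂ) :
    meijerGKernel k 0 a b s =
      (∏ j, Complex.Gamma (b j - s)) / ∏ j, Complex.Gamma (a j - s) := by
  have h1 : (Finset.univ.filter fun j : Fin k => k ≤ (j : ℕ)) = ∅ := by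
    ext j
    simp
  simp [meijerGKernel, h1]

/-- By Gauss's multiplication formula the three groups of Gamma factors collapse to the three
Gamma values of the Mellin transform. -/
theorem meijerGKernel_raney {k l : ℕ} (hl : 1 ≤ l) (hlk : l < k) {p r : ℝ}
    (hp : p = (k : ℝ) / (l : ℝ)) (hr : 0 < r) (s : ℂ) :
    meijerGKernel k 0 (fun j : Fin k => (raneyAlpha k l r j : ℂ))
      (fun j : Fin k => (raneyBeta k r j : ℂ)) s =
      meijerFactor k p r * l * (raneyEndpoint p : ℂ) ^ (l * s) * raneyMellin p r (-(l * s)) := by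
  obtain ⟨n, hn, rfl⟩ : ∃ n, 0 < n ∧ k = l + n := ⟨k - l, by omega, by omega⟩
  have hl0 : (0 : ℝ) < l := by exact_mod_cast hl
  have hn0 : (0 : ℝ) < n := by exact_mod_cast hn
  have hk0 : (0 : ℝ) < (l + n : ℕ) := by positivity
  have hlC : (l : ℂ) ≠ 0 := by exact_mod_cast hl0.ne'
  have hnC : (n : ℂ) ≠ 0 := by exact_mod_cast hn0.ne'
  have hkC : ((l + n : ℕ) : ℂ) ≠ 0 := by exact_mod_cast hk0.ne'
  have hrC : (r : ℂ) ≠ 0 := by exact_mod_cast hr.ne'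
  have hq : p - 1 = (n : ℝ) / l := by
    rw [hp]; push_cast; field_simp; ring
  have hp0 : 0 < p := by rw [hp]; positivity
  have hq0 : 0 < p - 1 := by rw [hq]; positivity
  have hβ : ∏ j : Fin (l + n), Complex.Gamma ((raneyBeta (l + n) r j : ℂ) - s) =
      (((2 * Real.pi) ^ ((((l + n : ℕ) : ℝ) - 1) / 2) : ℝ) : ℂ) *
        ((l + n : ℕ) : ℂ) ^ (1 / 2 - (r - (l + n : ℕ) * s)) *
        Complex.Gamma (r - (l + n : ℕ) * s) := by
    have h1 := Complex.prod_Gamma_add_div (l + n) (by omega) (r / (l + n : ℕ) - s)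
    rw [mul_sub, mul_div_cancel₀ _ hkC] at h1
    rw [← h1, Finset.prod_range]
    refine Finset.prod_congr rfl fun j _ => ?_
    simp only [raneyBeta]
    push_cast
    congr 1
    ring
  have hα : ∏ j : Fin (l + n), Complex.Gamma ((raneyAlpha (l + n) l r j : ℂ) - s) =
      ((((2 * Real.pi) ^ (((l : ℝ) - 1) / 2) : ℝ) : ℂ) *
        (l : ℂ) ^ (1 / 2 - (1 - l * s)) * Complex.Gamma (1 - l * s)) *
      ((((2 * Real.pi) ^ (((n : ℝ) - 1) / 2) : ℝ) : ℂ) *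
        (n : ℂ) ^ (1 / 2 - (r + 1 - n * s)) * Complex.Gamma (r + 1 - n * s)) := by
    have h1 := Complex.prod_Gamma_add_div l (by omega) (1 / l - s)
    have h2 := Complex.prod_Gamma_add_div n hn ((r + 1) / n - s)
    rw [mul_sub, mul_div_cancel₀ _ hlC] at h1
    rw [mul_sub, mul_div_cancel₀ _ hnC] at h2
    rw [← h1, ← h2, Fin.prod_univ_add, Finset.prod_range, Finset.prod_range]
    congr 1
    · refine Finset.prod_congr rfl fun j _ => ?_
      have : (j : ℕ) + 1 ≤ l := j.2
      simp only [raneyAlpha, Fin.val_castAdd, if_pos this]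
      push_cast
      congr 1
      ring
    · refine Finset.prod_congr rfl fun j _ => ?_
      have : ¬ (l + (j : ℕ) + 1 ≤ l) := by omega
      simp only [raneyAlpha, Fin.val_natAdd, if_neg this]
      push_cast
      congr 1
      rw [add_sub_cancel_left]
      ring
  rw [meijerGKernel_eq_prod_div_prod, hβ, hα, raneyMellin, meijerFactor]
  have hpl : (p : ℂ) * l = (l + n : ℕ) := by
    rw [hp]; push_cast; field_simp
  have hql : ((p : ℂ) - 1) * l = n := by
    rw [sub_mul, hpl]; push_cast; ring
  rw [show (p : ℂ) * -(l * s) + r = r - (l + n : ℕ) * s by rw [← hpl]; ring,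
    show -((l : ℂ) * s) + 1 = 1 - l * s by ring,
    show ((p : ℂ) - 1) * -(l * s) + r + 1 = r + 1 - n * s by rw [← hql]; ring]
  -- the remaining identity between powers of positive numbers is linear in their logarithms
  have hconst : (((2 * Real.pi) ^ ((((l + n : ℕ) : ℝ) - 1) / 2) : ℝ) : ℂ) *
        ((l + n : ℕ) : ℂ) ^ (1 / 2 - (r - (l + n : ℕ) * s)) =
      ((√(2 * (l + n : ℕ) * Real.pi) * p ^ (-r) * (p - 1) ^ (r + 1 / 2) : ℝ) : ℂ) * l *
        (raneyEndpoint p : ℂ) ^ (l * s) *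
      ((((2 * Real.pi) ^ (((l : ℝ) - 1) / 2) : ℝ) : ℂ) * (l : ℂ) ^ (1 / 2 - (1 - l * s)) *
      ((((2 * Real.pi) ^ (((n : ℝ) - 1) / 2) : ℝ) : ℂ) *
        (n : ℂ) ^ (1 / 2 - (r + 1 - n * s)))) := by
    have h2pi : 0 < 2 * Real.pi := by positivity
    have hlogp : Real.log p = Real.log (l + n : ℕ) - Real.log l := by
      rw [hp, Real.log_div hk0.ne' hl0.ne']
    have hlogq : Real.log (p - 1) = Real.log n - Real.log l := by
      rw [hq, Real.log_div hn0.ne' hl0.ne']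
    have hend : 0 < raneyEndpoint p :=
      mul_pos (Real.rpow_pos_of_pos hp0 _) (Real.rpow_pos_of_pos hq0 _)
    have hlogc : Real.log (raneyEndpoint p) =
        p * Real.log p + (1 - p) * Real.log (p - 1) := by
      rw [raneyEndpoint, Real.log_mul (Real.rpow_pos_of_pos hp0 _).ne'
        (Real.rpow_pos_of_pos hq0 _).ne', Real.log_rpow hp0, Real.log_rpow hq0]
    have hsqrt : √(2 * (l + n : ℕ) * Real.pi) =
        (2 * Real.pi) ^ (1 / 2 : ℝ) * ((l + n : ℕ) : ℝ) ^ (1 / 2 : ℝ) := by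
      rw [← Real.mul_rpow h2pi.le hk0.le, Real.sqrt_eq_rpow]
      congr 1
      ring
    have hlexp : (l : ℂ) = Complex.exp (Real.log l) := by
      rw [← Complex.ofReal_exp, Real.exp_log hl0, Complex.ofReal_natCast]
    have e1 := ofReal_cpow_eq_exp hk0 (1 / 2 - (r - (l + n : ℕ) * s))
    have e2 := ofReal_cpow_eq_exp hl0 (1 / 2 - (1 - l * s))
    have e3 := ofReal_cpow_eq_exp hn0 (1 / 2 - (r + 1 - n * s))
    rw [Complex.ofReal_natCast] at e1 e2 e3
    rw [e1, e2, e3, hsqrt, ofReal_cpow_eq_exp hend, Complex.ofReal_mul, Complex.ofReal_mul,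
      Complex.ofReal_mul, ofReal_rpow_eq_exp h2pi, ofReal_rpow_eq_exp h2pi, ofReal_rpow_eq_exp h2pi,
      ofReal_rpow_eq_exp h2pi, ofReal_rpow_eq_exp hk0, ofReal_rpow_eq_exp hp0,
      ofReal_rpow_eq_exp hq0, hlogc, hlogq, hlogp]
    nth_rw 1 [hlexp]
    simp only [← Complex.exp_add]
    congr 1
    generalize Real.log (l + n : ℕ) = x at *
    generalize Real.log l = y at *
    generalize Real.log n = w at *
    generalize Real.log (2 * Real.pi) = v at *
    push_cast at hpl ⊢
    linear_combination (-(s * (x - w))) * hpl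
  have h2pi : 0 < 2 * Real.pi := by positivity
  have n1 : (((2 * Real.pi) ^ (((l : ℝ) - 1) / 2) : ℝ) : ℂ) ≠ 0 := by
    exact_mod_cast (Real.rpow_pos_of_pos h2pi _).ne'
  have n2 : (((2 * Real.pi) ^ (((n : ℝ) - 1) / 2) : ℝ) : ℂ) ≠ 0 := by
    exact_mod_cast (Real.rpow_pos_of_pos h2pi _).ne'
  have n3 : (l : ℂ) ^ (1 / 2 - (1 - l * s)) ≠ 0 := by simp [Complex.cpow_eq_zero_iff, hlC]
  have n4 : (n : ℂ) ^ (1 / 2 - (r + 1 - n * s)) ≠ 0 := by simp [Complex.cpow_eq_zero_iff, hnC]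
  rw [hconst, Complex.ofReal_div]
  generalize ((√(2 * (l + n : ℕ) * Real.pi) * p ^ (-r) * (p - 1) ^ (r + 1 / 2) : ℝ) : ℂ) = K
  generalize (((2 * Real.pi) ^ (((l : ℝ) - 1) / 2) : ℝ) : ℂ) = A1 at *
  generalize (((2 * Real.pi) ^ (((n : ℝ) - 1) / 2) : ℝ) : ℂ) = A2 at *
  generalize (l : ℂ) ^ (1 / 2 - (1 - l * s)) = A3 at *
  generalize (n : ℂ) ^ (1 / 2 - (r + 1 - n * s)) = A4 at *
  generalize Complex.Gamma (1 - l * s) = G1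
  generalize Complex.Gamma (r + 1 - n * s) = G2
  generalize Complex.Gamma (r - (l + n : ℕ) * s) = G3
  field_simp

theorem raneyBeta_pos {k : ℕ} {r : ℝ} (hr : 0 < r) (i : Fin k) : 0 < raneyBeta k r i := by
  have : 0 < k := i.pos
  have : (0 : ℝ) < k := by exact_mod_cast this
  have : (0 : ℝ) ≤ (i : ℕ) := by positivity
  rw [raneyBeta]
  exact div_pos (by linarith) (by assumption)

theorem div_le_raneyAlpha {k l : ℕ} (hl : 1 ≤ l) (hlk : l < k) {p r : ℝ}
    (hp : p = (k : ℝ) / (l : ℝ)) (hr : 0 < r) (hrp : r ≤ p) (i : Fin k) :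
    r / k ≤ raneyAlpha k l r i := by
  have hl0 : (0 : ℝ) < l := by exact_mod_cast hl
  have hk0 : (0 : ℝ) < k := by exact_mod_cast (by omega : 0 < k)
  have hlk' : (0 : ℝ) < (k : ℝ) - l := sub_pos.mpr (by exact_mod_cast hlk)
  have hi0 : (0 : ℝ) ≤ (i : ℕ) := by positivity
  rw [raneyAlpha]
  split_ifs with h
  · rw [hp, le_div_iff₀ hl0] at hrp
    rw [div_le_div_iff₀ hk0 hl0]
    nlinarith
  · have h' : (l : ℝ) ≤ (i : ℕ) := by exact_mod_cast (by omega : l ≤ (i : ℕ))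
    exact div_le_div₀ (by linarith) (by linarith) hlk' (by linarith)

/-- The exponent of decay of the Mellin–Barnes kernel is `3 / 2`. -/
theorem sum_raneyBeta_sub_raneyAlpha {k l : ℕ} (hl : 1 ≤ l) (hlk : l < k) (r : ℝ) :
    ∑ j, (raneyBeta k r j - raneyAlpha k l r j) = -(3 / 2) := by
  obtain ⟨n, hn, rfl⟩ : ∃ n, 0 < n ∧ k = l + n := ⟨k - l, by omega, by omega⟩
  have hl0 : (0 : ℝ) < l := by exact_mod_cast hl
  have hn0 : (0 : ℝ) < n := by exact_mod_cast hn
  have hid : ∀ m : ℕ, ∑ i : Fin m, (i : ℝ) = m * (m - 1) / 2 := by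
    intro m
    rw [← Finset.sum_range (fun i => (i : ℝ))]
    induction m with
    | zero => simp
    | succ m ih => rw [Finset.sum_range_succ, ih]; push_cast; ring
  have h1 : ∑ j, raneyBeta (l + n) r j = r + ((l : ℝ) + n - 1) / 2 := by
    simp only [raneyBeta]
    rw [← Finset.sum_div]
    have h0 : ∀ i : Fin (l + n), r + ((i : ℝ) + 1) - 1 = r + i := fun i => by ring
    simp_rw [h0]
    rw [Finset.sum_add_distrib, hid]
    simp
    field_simp
  have h2 : ∑ j, raneyAlpha (l + n) l r j = ((l : ℝ) + 1) / 2 + r + ((n : ℝ) + 1) / 2 := by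
    rw [Fin.sum_univ_add]
    have e1 : ∀ j : Fin l, raneyAlpha (l + n) l r (Fin.castAdd n j) = ((j : ℝ) + 1) / l := by
      intro j
      have : (j : ℕ) + 1 ≤ l := j.2
      simp only [raneyAlpha, Fin.val_castAdd, if_pos this]
    have e2 : ∀ j : Fin n, raneyAlpha (l + n) l r (Fin.natAdd l j) = (r + 1 + (j : ℝ)) / n := by
      intro j
      have : ¬ (l + (j : ℕ) + 1 ≤ l) := by omega
      simp only [raneyAlpha, Fin.val_natAdd, if_neg this]
      push_cast
      rw [add_sub_cancel_left]
      congr 1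
      ring
    simp_rw [e1, e2]
    rw [← Finset.sum_div, ← Finset.sum_div, Finset.sum_add_distrib, Finset.sum_add_distrib, hid,
      hid]
    simp
    field_simp
    ring
  rw [Finset.sum_sub_distrib, h1, h2]
  ring

theorem continuous_Gamma_add_mul_I {σ : ℝ} (hσ : 0 < σ) :
    Continuous fun t : ℝ => Complex.Gamma (σ + t * Complex.I) := by
  rw [continuous_iff_continuousAt]
  intro t
  refine ContinuousAt.comp (f := fun t : ℝ => (σ + t * Complex.I : ℂ))
    (Complex.differentiableAt_Gamma _ fun m h => ?_).continuousAt (by fun_prop)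
  have := congrArg Complex.re h
  simp at this
  have h2 : (0 : ℝ) ≤ m := m.cast_nonneg
  linarith

/-- A quotient of products of Gamma functions is integrable along a vertical line if it decays
with an exponent greater than `1`. -/
theorem integrable_prod_Gamma_div_prod_Gamma {ι : Type*} [Fintype ι] {a b : ι → ℝ}
    (ha : ∀ j, 0 < a j) (hb : ∀ j, 0 < b j) (hab : ∑ j, (b j - a j) < -1) :
    Integrable fun t : ℝ => (∏ j, Complex.Gamma (b j + t * Complex.I)) /
      ∏ j, Complex.Gamma (a j + t * Complex.I) := by
  have hΓ : ∀ j (t : ℝ), Complex.Gamma (a j + t * Complex.I) ≠ 0 := fun j t =>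
    Complex.Gamma_ne_zero_of_re_pos (by simpa using ha j)
  have hcont : Continuous fun t : ℝ => (∏ j, Complex.Gamma (b j + t * Complex.I)) /
      ∏ j, Complex.Gamma (a j + t * Complex.I) := by
    refine Continuous.div ?_ ?_ fun t => Finset.prod_ne_zero_iff.mpr fun j _ => hΓ j t
    · exact continuous_finsetProd _ fun j _ => continuous_Gamma_add_mul_I (hb j)
    · exact continuous_finsetProd _ fun j _ => continuous_Gamma_add_mul_I (ha j)
  set e : ℝ := ∑ j, (b j - a j) with he
  have h1 : (fun t : ℝ => (∏ j, Complex.Gamma (b j + t * Complex.I)) /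
      ∏ j, Complex.Gamma (a j + t * Complex.I)) =O[cocompact ℝ] fun t : ℝ => |t| ^ e := by
    have h2 := Asymptotics.IsBigO.finsetProd (s := Finset.univ) (l := cocompact ℝ)
      fun j _ => Gamma_div_Gamma_isBigO (hb j) (ha j)
    simp_rw [Finset.prod_div_distrib] at h2
    refine h2.congr' EventuallyEq.rfl ?_
    have : ∀ᶠ t : ℝ in cocompact ℝ, 0 < ‖t‖ := tendsto_norm_cocompact_atTop.eventually_gt_atTop 0
    filter_upwards [this] with t ht
    rw [Real.norm_eq_abs] at ht
    rw [he, Real.rpow_sum_of_pos ht]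
  have h2 : (fun t : ℝ => |t| ^ e) =O[cocompact ℝ] fun t : ℝ => (1 + ‖t‖) ^ (-(-e)) := by
    refine Asymptotics.IsBigO.of_bound ((1 / 2 : ℝ) ^ e) ?_
    have : ∀ᶠ t : ℝ in cocompact ℝ, 1 ≤ ‖t‖ := tendsto_norm_cocompact_atTop.eventually_ge_atTop 1
    filter_upwards [this] with t ht
    rw [Real.norm_eq_abs] at ht
    rw [neg_neg, Real.norm_of_nonneg (by positivity), Real.norm_of_nonneg (by positivity),
      Real.norm_eq_abs, ← Real.mul_rpow (by norm_num) (by positivity)]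
    exact Real.rpow_le_rpow_of_nonpos (by positivity) (by linarith) (by linarith)
  have h3 : Integrable (fun t : ℝ => (1 + ‖t‖) ^ (-(-e))) :=
    integrable_one_add_norm (by simp; linarith)
  exact hcont.locallyIntegrable.integrable_of_isBigO_cocompact (h1.trans h2)
    (h3.integrableAtFilter _)

/-- The Mellin–Barnes integrand of the Meijer function, as the integrand of the inverse Mellin
transform. -/
theorem meijerGIntegrand_raney {k l : ℕ} (hl : 1 ≤ l) (hlk : l < k) {p r : ℝ}
    (hp : p = (k : ℝ) / (l : ℝ)) (hr : 0 < r) {x : ℝ} (hx : 0 < x) (s : ℂ) :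
    meijerGIntegrand k 0 (fun j : Fin k => (raneyAlpha k l r j : ℂ))
      (fun j : Fin k => (raneyBeta k r j : ℂ)) ((x ^ l / raneyEndpoint p ^ l : ℝ) : ℂ) s =
      meijerFactor k p r * l * ((x : ℂ) ^ (l * s) * raneyMellin p r (-(l * s))) := by
  have hl0 : (0 : ℝ) < l := by exact_mod_cast hl
  have hp1 : 1 < p := by
    rw [hp, lt_div_iff₀ hl0, one_mul]
    exact_mod_cast hlk
  have hc := raneyEndpoint_pos hp1
  have hz : ((x ^ l / raneyEndpoint p ^ l : ℝ) : ℂ) ^ s =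
      (x : ℂ) ^ (l * s) * ((raneyEndpoint p : ℂ) ^ (l * s))⁻¹ := by
    rw [ofReal_cpow_eq_exp (by positivity), ofReal_cpow_eq_exp hx, ofReal_cpow_eq_exp hc,
      ← Complex.exp_neg, ← Complex.exp_add, Real.log_div (by positivity) (by positivity),
      Real.log_pow, Real.log_pow]
    congr 1
    push_cast
    ring
  have hne : (raneyEndpoint p : ℂ) ^ ((l : ℂ) * s) ≠ 0 := by
    rw [ofReal_cpow_eq_exp hc]
    exact Complex.exp_ne_zero _
  rw [meijerGIntegrand, meijerGKernel_raney hl hlk hp hr, hz]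
  field_simp

theorem isMeijerGLine_zero {k : ℕ} {a b : Fin k → ℂ} {c : ℝ} :
    IsMeijerGLine k 0 a b c ↔ ∀ j, c < (b j).re := by
  simp [IsMeijerGLine]

theorem lt_of_isMeijerGLine_raney {k : ℕ} {r c : ℝ} (hk : 0 < k) {a : Fin k → ℂ}
    (h : IsMeijerGLine k 0 a (fun j : Fin k => (raneyBeta k r j : ℂ)) c) : c < r / k := by
  have := isMeijerGLine_zero.mp h ⟨0, hk⟩
  simpa [raneyBeta] using this

theorem integrable_meijerGIntegrand_raney {k l : ℕ} (hl : 1 ≤ l) (hlk : l < k) {p r : ℝ}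
    (hp : p = (k : ℝ) / (l : ℝ)) (hr : 0 < r) (hrp : r ≤ p) {z : ℝ} (hz : 0 < z) {c : ℝ}
    (hc : IsMeijerGLine k 0 (fun j : Fin k => (raneyAlpha k l r j : ℂ))
      (fun j : Fin k => (raneyBeta k r j : ℂ)) c) :
    Integrable fun t : ℝ => meijerGIntegrand k 0 (fun j : Fin k => (raneyAlpha k l r j : ℂ))
      (fun j : Fin k => (raneyBeta k r j : ℂ)) (z : ℂ) ((c : ℂ) + (t : ℂ) * Complex.I) := by
  have hck := lt_of_isMeijerGLine_raney (by omega) hc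
  have h1 := integrable_prod_Gamma_div_prod_Gamma (a := fun j => raneyAlpha k l r j - c)
    (b := fun j => raneyBeta k r j - c)
    (fun j => by linarith [div_le_raneyAlpha hl hlk hp hr hrp j])
    (fun j => by simpa using isMeijerGLine_zero.mp hc j)
    (by
      simp only [sub_sub_sub_cancel_right]
      rw [sum_raneyBeta_sub_raneyAlpha hl hlk]
      norm_num)
  have h2 := h1.comp_neg
  have h3 : Integrable fun t : ℝ => (z : ℂ) ^ ((c : ℂ) + (t : ℂ) * Complex.I) *
      ((∏ j, Complex.Gamma ((raneyBeta k r j : ℂ) - (c + t * Complex.I))) /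
        ∏ j, Complex.Gamma ((raneyAlpha k l r j : ℂ) - (c + t * Complex.I))) := by
    refine Integrable.bdd_mul (c := z ^ c) ?_ ?_ ?_
    · refine h2.congr (Eventually.of_forall fun t => ?_)
      have : ∀ y : ℝ, ((y - c : ℝ) : ℂ) + ((-t : ℝ) : ℂ) * Complex.I =
          (y : ℂ) - (c + t * Complex.I) := fun y => by push_cast; ring
      simp only [this]
    · refine Continuous.aestronglyMeasurable ?_
      simp_rw [ofReal_cpow_eq_exp hz]
      fun_prop
    · refine Eventually.of_forall fun t => ?_
      rw [Complex.norm_cpow_eq_rpow_re_of_pos hz]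
      simp
  refine h3.congr (Eventually.of_forall fun t => ?_)
  simp only [meijerGIntegrand, meijerGKernel_eq_prod_div_prod]
  ring

/-- Mellin inversion: along every admissible line the Mellin–Barnes integral has the value
`x W(x)`, up to a constant factor. -/
theorem meijerGLineIntegral_raney {k l : ℕ} (hl : 1 ≤ l) (hlk : l < k) {p r : ℝ}
    (hp : p = (k : ℝ) / (l : ℝ)) (hr : 0 < r) (hrp : r ≤ p) {x : ℝ}
    (hx : x ∈ Ioo 0 (raneyEndpoint p)) {c : ℝ}
    (hc : IsMeijerGLine k 0 (fun j : Fin k => (raneyAlpha k l r j : ℂ))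
      (fun j : Fin k => (raneyBeta k r j : ℂ)) c) :
    meijerGLineIntegral k 0 (fun j : Fin k => (raneyAlpha k l r j : ℂ))
      (fun j : Fin k => (raneyBeta k r j : ℂ)) c ((x ^ l / raneyEndpoint p ^ l : ℝ) : ℂ) =
      meijerFactor k p r * raneyProfile p r x := by
  have hl0 : (0 : ℝ) < l := by exact_mod_cast hl
  have hk0 : (0 : ℝ) < k := by exact_mod_cast (by omega : 0 < k)
  have hlC : (l : ℂ) ≠ 0 := by exact_mod_cast hl0.ne'
  have hp1 : 1 < p := by
    rw [hp, lt_div_iff₀ hl0, one_mul]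
    exact_mod_cast hlk
  have hF : meijerFactor k p r ≠ 0 := by
    have : 0 < p - 1 := by linarith
    have := Real.pi_pos
    rw [meijerFactor]
    positivity
  have hFC : (meijerFactor k p r : ℂ) ≠ 0 := by exact_mod_cast hF
  set σ : ℝ := -(l * c) with hσ
  have hσr : -(r / p) < σ := by
    have h1 := lt_of_isMeijerGLine_raney (by omega) hc
    have h2 : r / p = l * (r / k) := by rw [hp]; field_simp
    rw [h2, hσ, neg_lt_neg_iff]
    exact mul_lt_mul_of_pos_left h1 hl0
  -- the substitution `s = -u / l`
  have hsub : ∀ t : ℝ, ∀ y : ℝ, 0 < y → meijerGIntegrand k 0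
      (fun j : Fin k => (raneyAlpha k l r j : ℂ)) (fun j : Fin k => (raneyBeta k r j : ℂ))
      ((y ^ l / raneyEndpoint p ^ l : ℝ) : ℂ) ((c : ℂ) + (t : ℂ) * Complex.I) =
      meijerFactor k p r * l * ((y : ℂ) ^ (-((σ : ℂ) + ((-l * t : ℝ) : ℂ) * Complex.I)) *
        raneyMellin p r ((σ : ℂ) + ((-l * t : ℝ) : ℂ) * Complex.I)) := by
    intro t y hy
    have h1 : (l : ℂ) * (c + t * Complex.I) = -((σ : ℂ) + ((-l * t : ℝ) : ℂ) * Complex.I) := by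
      rw [hσ]; push_cast; ring
    rw [meijerGIntegrand_raney hl hlk hp hr hy, h1, neg_neg]
  have hvert : Complex.VerticalIntegrable (mellin fun x => (raneyProfile p r x : ℂ)) σ := by
    have h1 := integrable_meijerGIntegrand_raney hl hlk hp hr hrp
      (z := 1 ^ l / raneyEndpoint p ^ l) (by have := raneyEndpoint_pos hp1; positivity) hc
    simp_rw [fun t => hsub t 1 one_pos, Complex.ofReal_one, Complex.one_cpow, one_mul] at h1
    have h2 := h1.const_mul (meijerFactor k p r * l : ℂ)⁻¹
    have h3 := h2.comp_mul_left' (R := (-l : ℝ)⁻¹) (inv_ne_zero (neg_ne_zero.mpr hl0.ne'))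
    refine h3.congr (Eventually.of_forall fun y => ?_)
    have h4 : (-l : ℝ) * ((-l : ℝ)⁻¹ * y) = y := mul_inv_cancel_left₀ (neg_ne_zero.mpr hl0.ne') y
    simp only
    rw [h4, inv_mul_cancel_left₀ (mul_ne_zero hFC hlC), mellin_raneyProfile hp1 hr hrp (by simpa)]
  have hinv := mellinInv_mellin_eq σ (fun x => (raneyProfile p r x : ℂ)) hx.1
    (mellinConvergent_raneyProfile hp1 hr hrp (by simpa)) hvert
    (Complex.continuous_ofReal.continuousAt.comp (continuousAt_raneyProfile hp1 hx))
  rw [← hinv, mellinInv, meijerGLineIntegral]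
  simp_rw [fun t => hsub t x hx.1]
  have hmel : ∀ y : ℝ, mellin (fun x => (raneyProfile p r x : ℂ)) (σ + y * Complex.I) =
      raneyMellin p r (σ + y * Complex.I) := fun y => mellin_raneyProfile hp1 hr hrp (by simpa)
  simp_rw [hmel, smul_eq_mul]
  rw [integral_const_mul, Measure.integral_comp_mul_left (fun y : ℝ =>
    (x : ℂ) ^ (-((σ : ℂ) + (y : ℂ) * Complex.I)) * raneyMellin p r ((σ : ℂ) + (y : ℂ) * Complex.I))]
  rw [inv_neg, abs_neg, abs_of_pos (inv_pos.mpr hl0), Complex.real_smul]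
  rw [Complex.real_smul]
  generalize (∫ y : ℝ, (x : ℂ) ^ (-((σ : ℂ) + (y : ℂ) * Complex.I)) *
    raneyMellin p r ((σ : ℂ) + (y : ℂ) * Complex.I)) = J
  push_cast
  field_simp

/-! ### The measure -/

/-- The density `W`, which vanishes outside `(0, c(p))` because `raneyProfile p r` does. -/
def raneyDensity (p r x : ℝ) : ℝ := raneyProfile p r x / x

theorem raneyDensity_of_notMem {p r x : ℝ} (hx : x ∉ Ioo 0 (raneyEndpoint p)) :
    raneyDensity p r x = 0 := by
  rw [raneyDensity, raneyProfile_of_notMem hx, zero_div]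

theorem raneyDensity_nonneg {p r : ℝ} (hp : 1 < p) (hr : 0 < r) (hrp : r ≤ p) (x : ℝ) :
    0 ≤ raneyDensity p r x := by
  by_cases hx : x ∈ Ioo 0 (raneyEndpoint p)
  · exact div_nonneg (raneyProfile_nonneg hp hr hrp x) hx.1.le
  · rw [raneyDensity_of_notMem hx]

theorem continuousOn_raneyDensity {p r : ℝ} (hp : 1 < p) :
    ContinuousOn (raneyDensity p r) (Ioo 0 (raneyEndpoint p)) := fun _ hx =>
  ((continuousAt_raneyProfile hp hx).div continuousAt_id hx.1.ne').continuousWithinAt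

theorem measurable_raneyDensity {p r : ℝ} (hp : 1 < p) : Measurable (raneyDensity p r) :=
  (measurable_raneyProfile hp r).div measurable_id

theorem integrable_raneyDensity_mul_pow {p r : ℝ} (hp : 1 < p) (hr : 0 < r) (hrp : r ≤ p)
    (m : ℕ) : Integrable (fun x => raneyDensity p r x * x ^ m) ∧
      ∫ x, raneyDensity p r x * x ^ m = raneyNumber p r m := by
  have hp0 : 0 < p := by linarith
  have hm : -(r / p) < (m : ℂ).re := by
    have : 0 < r / p := by positivity
    have : (0 : ℝ) ≤ m := m.cast_nonneg
    rw [Complex.natCast_re]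
    linarith
  have hcongr : ∀ x ∈ Ioi (0 : ℝ), (x : ℂ) ^ ((m : ℂ) - 1) • (raneyProfile p r x : ℂ) =
      ((raneyDensity p r x * x ^ m : ℝ) : ℂ) := by
    intro x hx
    have hx' : (x : ℂ) ≠ 0 := by exact_mod_cast (ne_of_gt hx)
    rw [Complex.cpow_sub _ _ hx', Complex.cpow_one, Complex.cpow_natCast, raneyDensity, smul_eq_mul]
    push_cast
    ring
  have hsupp : Function.support (fun x => raneyDensity p r x * x ^ m) ⊆ Ioi 0 := by
    intro x hx
    by_contra h
    exact hx (by simp [raneyDensity_of_notMem fun h' => h h'.1])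
  have h1 := mellinConvergent_raneyProfile hp hr hrp hm
  have h2 := mellin_raneyProfile hp hr hrp hm
  rw [MellinConvergent, integrableOn_congr_fun hcongr measurableSet_Ioi] at h1
  rw [raneyMellin_natCast hp hr, mellin, setIntegral_congr_fun measurableSet_Ioi hcongr,
    integral_complex_ofReal] at h2
  refine ⟨(integrableOn_iff_integrable_of_support_subset hsupp).mp ?_, ?_⟩
  · exact h1.re
  · rw [← setIntegral_eq_integral_of_forall_compl_eq_zero fun x hx =>
      Function.notMem_support.mp fun h => hx (hsupp h)]
    exact_mod_cast h2

/-- The measure with density `W`. -/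
def raneyMeasure (p r : ℝ) : Measure ℝ :=
  volume.withDensity fun x => ENNReal.ofReal (raneyDensity p r x)

theorem isRaneyMeasure_raneyMeasure {p r : ℝ} (hp : 1 < p) (hr : 0 < r) (hrp : r ≤ p) :
    IsRaneyMeasure p r (raneyMeasure p r) := by
  have hnn := raneyDensity_nonneg hp hr hrp
  have hmeas : Measurable fun x => ENNReal.ofReal (raneyDensity p r x) :=
    (measurable_raneyDensity hp).ennreal_ofReal
  have hlt : ∀ᵐ x : ℝ, ENNReal.ofReal (raneyDensity p r x) < ⊤ :=
    Eventually.of_forall fun _ => ENNReal.ofReal_lt_top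
  refine ⟨⟨?_⟩, fun m => ?_, fun m => ?_⟩
  · obtain ⟨h1, h2⟩ := integrable_raneyDensity_mul_pow hp hr hrp 0
    simp only [pow_zero, mul_one] at h1 h2
    rw [raneyMeasure, withDensity_apply _ MeasurableSet.univ, setLIntegral_univ,
      ← ofReal_integral_eq_lintegral_ofReal h1 (Eventually.of_forall hnn), h2]
    simp [raneyNumber]
  · rw [raneyMeasure, integrable_withDensity_iff_integrable_smul' hmeas hlt]
    simpa only [ENNReal.toReal_ofReal (hnn _), smul_eq_mul] using
      (integrable_raneyDensity_mul_pow hp hr hrp m).1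
  · rw [raneyMeasure, integral_withDensity_eq_integral_toReal_smul hmeas hlt]
    simpa only [ENNReal.toReal_ofReal (hnn _), smul_eq_mul] using
      (integrable_raneyDensity_mul_pow hp hr hrp m).2

theorem raneyNumber_le_pow {p r : ℝ} (hp : 1 < p) (hr : 0 < r) (hrp : r ≤ p) (m : ℕ) :
    raneyNumber p r m ≤ raneyEndpoint p ^ m := by
  obtain ⟨h1, h2⟩ := integrable_raneyDensity_mul_pow hp hr hrp m
  obtain ⟨h3, h4⟩ := integrable_raneyDensity_mul_pow hp hr hrp 0
  simp only [pow_zero, mul_one] at h3 h4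
  calc raneyNumber p r m = ∫ x, raneyDensity p r x * x ^ m := h2.symm
    _ ≤ ∫ x, raneyDensity p r x * raneyEndpoint p ^ m := by
      refine integral_mono h1 (h3.mul_const _) fun x => ?_
      by_cases hx : x ∈ Ioo 0 (raneyEndpoint p)
      · exact mul_le_mul_of_nonneg_left (pow_le_pow_left₀ hx.1.le hx.2.le m)
          (raneyDensity_nonneg hp hr hrp x)
      · simp [raneyDensity_of_notMem hx]
    _ = raneyEndpoint p ^ m := by
      rw [integral_mul_const, h4]
      simp [raneyNumber]

theorem IsRaneyMeasure.eq_raneyMeasure {p r : ℝ} (hp : 1 < p) (hr : 0 < r) (hrp : r ≤ p)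
    {μ : Measure ℝ} (hμ : IsRaneyMeasure p r μ) : μ = raneyMeasure p r := by
  have h := isRaneyMeasure_raneyMeasure hp hr hrp
  have := hμ.isProbabilityMeasure
  have := h.isProbabilityMeasure
  exact measure_eq_of_moment_eq hμ.integrable_pow h.integrable_pow
    (fun m => by rw [hμ.moment_eq, h.moment_eq])
    fun m => by rw [hμ.moment_eq]; exact raneyNumber_le_pow hp hr hrp m

theorem mainTheorem3 (k l : ℕ) (hl : 1 ≤ l) (hlk : l < k) (p r : ℝ)
    (hp : p = (k : ℝ) / (l : ℝ)) (hr : 0 < r) (hrp : r ≤ p) :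
    (∃! μ : Measure ℝ, IsRaneyMeasure p r μ) ∧
    ∀ μ : Measure ℝ, IsRaneyMeasure p r μ →
      ∃ W : ℝ → ℝ,
        (∀ x, 0 ≤ W x) ∧
        ContinuousOn W (Ioo 0 (raneyEndpoint p)) ∧
        (∀ x, x ∉ Ioo 0 (raneyEndpoint p) → W x = 0) ∧
        μ = volume.withDensity (fun x => ENNReal.ofReal (W x)) ∧
        ∀ x ∈ Ioo 0 (raneyEndpoint p),
          MeijerGConverges k 0 (fun j : Fin k => (raneyAlpha k l r j : ℂ))
            (fun j : Fin k => (raneyBeta k r j : ℂ))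
            ((x ^ l / raneyEndpoint p ^ l : ℝ) : ℂ) ∧
          (W x : ℂ) =
            ((r * p ^ r / (x * (p - 1) ^ (r + 1 / 2) * √(2 * (k : ℝ) * Real.pi)) : ℝ) : ℂ) *
              meijerG k 0 (fun j : Fin k => (raneyAlpha k l r j : ℂ))
                (fun j : Fin k => (raneyBeta k r j : ℂ))
                ((x ^ l / raneyEndpoint p ^ l : ℝ) : ℂ) := by
  have hl0 : (0 : ℝ) < l := by exact_mod_cast hl
  have hk0 : (0 : ℝ) < k := by exact_mod_cast (by omega : 0 < k)
  have hp1 : 1 < p := by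
    rw [hp, lt_div_iff₀ hl0, one_mul]
    exact_mod_cast hlk
  have hp0 : 0 < p := by linarith
  have hc := raneyEndpoint_pos hp1
  have hex : ∃ c : ℝ, IsMeijerGLine k 0 (fun j : Fin k => (raneyAlpha k l r j : ℂ))
      (fun j : Fin k => (raneyBeta k r j : ℂ)) c :=
    ⟨0, isMeijerGLine_zero.mpr fun j => by simpa using raneyBeta_pos hr j⟩
  refine ⟨⟨raneyMeasure p r, isRaneyMeasure_raneyMeasure hp1 hr hrp,
    fun μ hμ => hμ.eq_raneyMeasure hp1 hr hrp⟩, fun μ hμ => ⟨raneyDensity p r,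
    raneyDensity_nonneg hp1 hr hrp, continuousOn_raneyDensity hp1,
    fun x hx => raneyDensity_of_notMem hx, hμ.eq_raneyMeasure hp1 hr hrp, fun x hx => ?_⟩⟩
  refine ⟨⟨hex, fun c hcl => ?_, fun c c' hcl hcl' => ?_⟩, ?_⟩
  · exact integrable_meijerGIntegrand_raney hl hlk hp hr hrp
      (div_pos (pow_pos hx.1 l) (pow_pos hc l)) hcl
  · rw [meijerGLineIntegral_raney hl hlk hp hr hrp hx hcl,
      meijerGLineIntegral_raney hl hlk hp hr hrp hx hcl']
  · rw [meijerG, dif_pos hex, meijerGLineIntegral_raney hl hlk hp hr hrp hx hex.choose_spec,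
      ← Complex.ofReal_mul, ← Complex.ofReal_mul, Complex.ofReal_inj, raneyDensity, meijerFactor]
    have hx0 := hx.1
    have h1 : 0 < (p - 1) ^ (r + 1 / 2) := Real.rpow_pos_of_pos (by linarith) _
    have h2 : 0 < √(2 * (k : ℝ) * Real.pi) := by
      have := Real.pi_pos
      positivity
    have h3 : 0 < p ^ r := Real.rpow_pos_of_pos hp0 _
    rw [Real.rpow_neg hp0.le]
    generalize (p - 1) ^ (r + 1 / 2) = A at *
    generalize √(2 * (k : ℝ) * Real.pi) = B at *
    field_simp

end
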